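/- Let $\mathrm{AP}$ be a set of propositions and $\mathrm{Var}$ a set of variables. The formulas of pLTL$_\Diamond$ are $$\varphi ::= a \mid \neg a \mid \varphi\wedge\varphi \mid \varphi\vee\varphi \mid \bigcirc\varphi \mid \varphi\,\mathsf U\,\varphi \mid \varphi\,\mathsf R\,\varphi \mid \Box\varphi \mid \Diamond_{\le x}\varphi \mid \Diamond_{\le c}\varphi \mid \Box_{\le c}\varphi$$ with $a\in\mathrm{AP}$, $x\in\mathrm{Var}$, $c\in\mathbb N$. For a valuation $v:\mathrm{Var}\to\mathbb N$, an infinite word $w$ over $2^{\mathrm{AP}}$ and a position $i\in\mathbb N$, satisfaction $(w,i,v)\models\varphi$ is defined as usual for LTL (in particular $\varphi_1\mathsf R\varphi_2\equiv\neg(\neg\varphi_1\mathsf U\neg\varphi_2)$), with $(w,i,v)\models\Diamond_{\le x}\varphi$ iff $(w,j,v)\models\varphi$ for some $j$ with $i\le j\le i+v(x)$, and similarly for $\Diamond_{\le c}$ (some $j$ with $i\le j\le i+c$) and $\Box_{\le c}$ (all such $j$). The length $|\varphi|$ is the number of occurrences of literals and operators in $\varphi$, where every occurrence of a constant bound $c$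 contributes $c$ more (constants are written in unary). Let $M=(S,\mathbf P,s_0,L)$ be a finite discrete-time Markov chain with $m=|S|$ states, initial state $s_0$ and labelling $L:S\to2^{\mathrm{AP}}$, and let $\Pr(M\models v(\varphi))$ be the probability that an infinite path $s_0s_1s_2\cdots$ of $M$ satisfies $(L(s_0)L(s_1)L(s_2)\cdots,0,v)\models\varphi$. Put $V_{=1}(\varphi)=\{v:\mathrm{Var}\to\mathbb N\mid \Pr(M\models v(\varphi))=1\}$. Then for every pLTL$_\Diamond$-formula $\varphi$ and every such $M$, $$V_{=1}(\varphi)\neq\emptyset\quad\Longleftrightarrow\quad \bar v\in V_{=1}(\varphi),\qquad\text{where } \bar v(x)=m\cdot|\varphi|\cdot2^{|\varphi|}\text{ for all }x\in\mathrm{Var}.$$ -/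

import Mathlib

open MeasureTheory ProbabilityTheory
open scoped ENNReal

noncomputable section

namespace PLTL

/-- A finite discrete-time Markov chain with state space `S`, labelled over the propositions `AP`. -/
structure MarkovChain (S AP : Type*) [Fintype S] where
  /-- one-step transition probabilities -/
  P : S → S → ℝ
  P_nonneg : ∀ s t, 0 ≤ P s t
  P_sum : ∀ s, ∑ t, P s t = 1
  /-- initial state -/
  s₀ : S
  /-- state labelling -/
  L : S → Set AP

namespace MarkovChain

variable {S AP : Type*} [Fintype S] (M : MarkovChain S AP)

theorem sum_ofReal_P (s : S) : ∑ t, ENNReal.ofReal (M.P s t) = 1 := by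
  rw [← ENNReal.ofReal_sum_of_nonneg (fun t _ => M.P_nonneg s t), M.P_sum, ENNReal.ofReal_one]

/-- The distribution of the next state, given the current one. -/
def step (s : S) : PMF S :=
  PMF.ofFintype (fun t => ENNReal.ofReal (M.P s t)) (M.sum_ofReal_P s)

/-- The one-step transition kernel. -/
def stepKernel [MeasurableSpace S] [DiscreteMeasurableSpace S] : Kernel S S where
  toFun s := (M.step s).toMeasure
  measurable' := Measurable.of_discrete

instance [MeasurableSpace S] [DiscreteMeasurableSpace S] : IsMarkovKernel M.stepKernel :=
  ⟨fun s => inferInstanceAs (IsProbabilityMeasure (M.step s).toMeasure)⟩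

/-- The kernel giving the state at time `n + 1` from the states at times `0, …, n`:
it only looks at the state at time `n`. -/
def historyKernel [MeasurableSpace S] [DiscreteMeasurableSpace S] (n : ℕ) :
    Kernel ((_ : Finset.Iic n) → S) S :=
  M.stepKernel.comap (fun h => h ⟨n, Finset.mem_Iic.2 le_rfl⟩) (measurable_pi_apply _)

instance [MeasurableSpace S] [DiscreteMeasurableSpace S] (n : ℕ) :
    IsMarkovKernel (M.historyKernel n) := by
  unfold historyKernel; infer_instance

/-- The law of the chain on infinite state sequences (with the product σ-algebra, generated by the
cylinders), started in `M.s₀`; it is given by the Ionescu-Tulcea construction. -/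
def pathMeasure [MeasurableSpace S] [DiscreteMeasurableSpace S] : Measure (ℕ → S) :=
  Kernel.traj (X := fun _ => S) M.historyKernel 0 (fun _ => M.s₀)

/-- The infinite paths of the chain from its initial state. -/
def Paths : Set (ℕ → S) :=
  {π | π 0 = M.s₀ ∧ ∀ i, 0 < M.P (π i) (π (i + 1))}

/-- The infinite word induced by a path. -/
def trace (π : ℕ → S) : ℕ → Set AP := fun i => M.L (π i)

end MarkovChain

/-- Formulas of the fragment of parametric LTL in negation normal form whose only parametrized
operator is the bounded eventuality with a variable upper bound. -/
inductive Formula (AP Var : Type*) : Type _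
  | atom (a : AP)
  | natom (a : AP)
  | and (φ ψ : Formula AP Var)
  | or (φ ψ : Formula AP Var)
  | next (φ : Formula AP Var)
  | until (φ ψ : Formula AP Var)
  | release (φ ψ : Formula AP Var)
  | always (φ : Formula AP Var)
  | eventuallyLEVar (x : Var) (φ : Formula AP Var)
  | eventuallyLEConst (c : ℕ) (φ : Formula AP Var)
  | alwaysLEConst (c : ℕ) (φ : Formula AP Var)

namespace Formula

variable {AP Var : Type*}

/-- The satisfaction relation `(w, i, v) ⊨ φ`. -/
def Sat (w : ℕ → Set AP) (v : Var → ℕ) : Formula AP Var → ℕ → Prop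
  | atom a, i => a ∈ w i
  | natom a, i => a ∉ w i
  | and φ ψ, i => Sat w v φ i ∧ Sat w v ψ i
  | or φ ψ, i => Sat w v φ i ∨ Sat w v ψ i
  | next φ, i => Sat w v φ (i + 1)
  | .until φ ψ, i => ∃ j, i ≤ j ∧ Sat w v ψ j ∧ ∀ k, i ≤ k → k < j → Sat w v φ k
  | release φ ψ, i => ¬ ∃ j, i ≤ j ∧ ¬ Sat w v ψ j ∧ ∀ k, i ≤ k → k < j → ¬ Sat w v φ k
  | always φ, i => ∀ j, i ≤ j → Sat w v φ j
  | eventuallyLEVar x φ, i => ∃ j, i ≤ j ∧ j ≤ i + v x ∧ Sat w v φ j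
  | eventuallyLEConst c φ, i => ∃ j, i ≤ j ∧ j ≤ i + c ∧ Sat w v φ j
  | alwaysLEConst c φ, i => ∀ j, i ≤ j → j ≤ i + c → Sat w v φ j

/-- The length `|φ|`: literals and operators count one each, and a constant bound `c`
contributes `c` more (constants are written in unary). -/
def length : Formula AP Var → ℕ
  | atom _ => 1
  | natom _ => 1
  | and φ ψ => φ.length + ψ.length + 1
  | or φ ψ => φ.length + ψ.length + 1
  | next φ => φ.length + 1
  | .until φ ψ => φ.length + ψ.length + 1
  | release φ ψ => φ.length + ψ.length + 1
  | always φ => φ.length + 1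
  | eventuallyLEVar _ φ => φ.length + 1
  | eventuallyLEConst c φ => φ.length + c + 1
  | alwaysLEConst c φ => φ.length + c + 1

end Formula

namespace MarkovChain

variable {S AP Var : Type*} [Fintype S] [MeasurableSpace S] [DiscreteMeasurableSpace S]

/-- `Pr (M ⊨ v(φ))`. -/
def prob (M : MarkovChain S AP) (φ : Formula AP Var) (v : Var → ℕ) : ℝ≥0∞ :=
  M.pathMeasure {π | π ∈ M.Paths ∧ φ.Sat (M.trace π) v 0}

/-- The valuation set `V_{=1}(φ)`. -/
def VEqOne (M : MarkovChain S AP) (φ : Formula AP Var) : Set (Var → ℕ) :=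
  {v | M.prob φ v = 1}

end MarkovChain

end PLTL

end

/-!
Call a path of the transition graph fair if every finite path fragment starting in a state that
recurs infinitely often occurs infinitely often itself. Almost every path is fair
(`MarkovChain.ae_fair`, by Lévy's form of the Borel–Cantelli lemma). A formula true on a fair path
is true on all fair paths with a certain common prefix, and such a prefix has positive probability.
So almost sure satisfaction means satisfaction on all fair paths
(`MarkovChain.const_mem_VEqOne_iff`), and the theorem becomes a statement about the finite
transition graph: by monotonicity in the valuation, it remains to show that a violation on a fair
path for the uniform bound `N = m |φ| 2 ^ |φ|` yields one for every larger bound.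

Truth on a fair path is witnessed by a finite certificate (`Fair.provable`, `Cert.sat`): finitely
many claims "this formula holds at this position", each justified by claims at the same and the
next position. The invariants occurring in releases, which hold forever, are cut off at a state
from which they hold inevitably, on all fair paths. A release that is never released does reach such
a state: if a violation were possible from a recurrent state, it would occur infinitely often.

The negation of the given formula is bounded by the parameter only in invariants `palw`. A window
of length `N` contains two positions with the same state and the same claims between which no
window of another such formula starts; here `2 ^ |φ|` bounds the number of sets of claims, and the
factor `|φ|` makes up for the positions where windows start. Repeating the segment between the two
positions gives a certificate with fewer windows that end with the bound, and after finitely many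
steps all windows are longer (`exists_longer_windows`). The leaves of the new certificate have to be
inevitable for the bound `N + 1` rather than `N`. This is dual: a formula whose bounded operators
are eventualities `pev` has, as segments with equal ends can be removed, a certificate not longer
than `N`, in which every eventuality is fulfilled within `N` steps (`exists_short_cert`). The two
directions are proved simultaneously by induction on the length (`sat_change`).
-/

namespace PLTL

open Filter

/-! ### State formulas -/

/-- Linear temporal formulas in negation normal form over sequences of states, closed under
negation. Literals are arbitrary state predicates; `bex c`, `ball c` are the eventuality and the
invariant bounded by the constant `c`, and `pev`, `palw` those bounded by the parameter. All
occurrences of the parameter share one value, which `Sat` takes as an argument. -/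
inductive NNF (S : Type*) : Type _
  | lit (p : S → Prop)
  | and (f g : NNF S)
  | or (f g : NNF S)
  | next (f : NNF S)
  | untl (f g : NNF S)
  | rels (f g : NNF S)
  | ev (f : NNF S)
  | alw (f : NNF S)
  | bex (c : ℕ) (f : NNF S)
  | ball (c : ℕ) (f : NNF S)
  | pev (f : NNF S)
  | palw (f : NNF S)

namespace NNF

variable {S : Type*}

/-- Satisfaction along the state sequence `π` at a position, the parameter having the value `K`. -/
def Sat (K : ℕ) (π : ℕ → S) : NNF S → ℕ → Prop
  | lit p, i => p (π i)
  | and f g, i => Sat K π f i ∧ Sat K π g i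
  | or f g, i => Sat K π f i ∨ Sat K π g i
  | next f, i => Sat K π f (i + 1)
  | untl f g, i => ∃ j, Sat K π g (i + j) ∧ ∀ k < j, Sat K π f (i + k)
  | rels f g, i => ∀ j, Sat K π g (i + j) ∨ ∃ k < j, Sat K π f (i + k)
  | ev f, i => ∃ j, Sat K π f (i + j)
  | alw f, i => ∀ j, Sat K π f (i + j)
  | bex c f, i => ∃ j ≤ c, Sat K π f (i + j)
  | ball c f, i => ∀ j ≤ c, Sat K π f (i + j)
  | pev f, i => ∃ j ≤ K, Sat K π f (i + j)
  | palw f, i => ∀ j ≤ K, Sat K π f (i + j)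

/-- The dual formula, equivalent to the negation. -/
def neg : NNF S → NNF S
  | lit p => lit fun s => ¬ p s
  | and f g => or f.neg g.neg
  | or f g => and f.neg g.neg
  | next f => next f.neg
  | untl f g => rels f.neg g.neg
  | rels f g => untl f.neg g.neg
  | ev f => alw f.neg
  | alw f => ev f.neg
  | bex c f => ball c f.neg
  | ball c f => bex c f.neg
  | pev f => palw f.neg
  | palw f => pev f.neg

/-- The length of a formula, constants being counted in unary. -/
def length : NNF S → ℕ
  | lit _ => 1
  | and f g => f.length + g.length + 1
  | or f g => f.length + g.length + 1
  | next f => f.length + 1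
  | untl f g => f.length + g.length + 1
  | rels f g => f.length + g.length + 1
  | ev f => f.length + 1
  | alw f => f.length + 1
  | bex c f => f.length + c + 1
  | ball c f => f.length + c + 1
  | pev f => f.length + 1
  | palw f => f.length + 1

/-- No occurrence of `pev`. -/
def PevFree : NNF S → Prop
  | lit _ => True
  | and f g => f.PevFree ∧ g.PevFree
  | or f g => f.PevFree ∧ g.PevFree
  | next f => f.PevFree
  | untl f g => f.PevFree ∧ g.PevFree
  | rels f g => f.PevFree ∧ g.PevFree
  | ev f => f.PevFree
  | alw f => f.PevFree
  | bex _ f => f.PevFree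
  | ball _ f => f.PevFree
  | pev _ => False
  | palw f => f.PevFree

/-- No occurrence of `palw`. -/
def PalwFree : NNF S → Prop
  | lit _ => True
  | and f g => f.PalwFree ∧ g.PalwFree
  | or f g => f.PalwFree ∧ g.PalwFree
  | next f => f.PalwFree
  | untl f g => f.PalwFree ∧ g.PalwFree
  | rels f g => f.PalwFree ∧ g.PalwFree
  | ev f => f.PalwFree
  | alw f => f.PalwFree
  | bex _ f => f.PalwFree
  | ball _ f => f.PalwFree
  | pev f => f.PalwFree
  | palw _ => False

theorem sat_neg (K : ℕ) (π : ℕ → S) (f : NNF S) (i : ℕ) :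
    f.neg.Sat K π i ↔ ¬ f.Sat K π i := by
  induction f generalizing i <;> simp_all [neg, Sat, imp_iff_not_or]

theorem length_neg (f : NNF S) : f.neg.length = f.length := by
  induction f <;> simp_all [neg, length]

theorem pevFree_neg (f : NNF S) : f.neg.PevFree ↔ f.PalwFree := by
  induction f <;> simp_all [neg, PevFree, PalwFree]

theorem palwFree_neg (f : NNF S) : f.neg.PalwFree ↔ f.PevFree := by
  induction f <;> simp_all [neg, PevFree, PalwFree]

theorem length_pos (f : NNF S) : 0 < f.length := by
  cases f <;> simp [length]

theorem sat_shift (K : ℕ) (π : ℕ → S) (i : ℕ) (f : NNF S) (j : ℕ) :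
    f.Sat K (fun k => π (i + k)) j ↔ f.Sat K π (i + j) := by
  induction f generalizing j <;> simp_all [Sat, add_assoc]

open scoped Classical in
/-- The subformulas of a formula; those of `bex c f` and `ball c f` include the same formulas with
smaller constants, through which their truth values propagate step by step. -/
noncomputable def cl : NNF S → Finset (NNF S)
  | lit p => {lit p}
  | and f g => insert (and f g) (f.cl ∪ g.cl)
  | or f g => insert (or f g) (f.cl ∪ g.cl)
  | next f => insert (next f) f.cl
  | untl f g => insert (untl f g) (f.cl ∪ g.cl)
  | rels f g => insert (rels f g) (f.cl ∪ g.cl)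
  | ev f => insert (ev f) f.cl
  | alw f => insert (alw f) f.cl
  | bex c f => (Finset.range (c + 1)).image (fun k => bex k f) ∪ f.cl
  | ball c f => (Finset.range (c + 1)).image (fun k => ball k f) ∪ f.cl
  | pev f => insert (pev f) f.cl
  | palw f => insert (palw f) f.cl

theorem self_mem_cl (f : NNF S) : f ∈ f.cl := by
  cases f <;> simp [cl]

theorem card_cl_le (f : NNF S) : f.cl.card ≤ f.length := by
  classical
  have bin : ∀ (h : NNF S) (A B : Finset (NNF S)) (a b : ℕ), A.card ≤ a → B.card ≤ b →
      (insert h (A ∪ B)).card ≤ a + b + 1 := fun h A B a b ha hb =>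
    (Finset.card_insert_le _ _).trans (Nat.succ_le_succ ((Finset.card_union_le _ _).trans
      (add_le_add ha hb)))
  have un : ∀ (h : NNF S) (A : Finset (NNF S)) (a : ℕ), A.card ≤ a →
      (insert h A).card ≤ a + 1 := fun h A a ha =>
    (Finset.card_insert_le _ _).trans (Nat.succ_le_succ ha)
  have bd : ∀ (h : ℕ → NNF S) (c : ℕ) (A : Finset (NNF S)) (a : ℕ), A.card ≤ a →
      ((Finset.range (c + 1)).image h ∪ A).card ≤ a + c + 1 := fun h c A a ha => by
    have h1 := Finset.card_union_le ((Finset.range (c + 1)).image h) A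
    have h2 := Finset.card_image_le (s := Finset.range (c + 1)) (f := h)
    rw [Finset.card_range] at h2
    omega
  induction f with
  | lit p => simp [cl, length]
  | and f g hf hg => simp only [cl, length]; convert bin _ _ _ _ _ hf hg
  | or f g hf hg => simp only [cl, length]; convert bin _ _ _ _ _ hf hg
  | untl f g hf hg => simp only [cl, length]; convert bin _ _ _ _ _ hf hg
  | rels f g hf hg => simp only [cl, length]; convert bin _ _ _ _ _ hf hg
  | next f hf => simp only [cl, length]; convert un _ _ _ hf
  | ev f hf => simp only [cl, length]; convert un _ _ _ hf
  | alw f hf => simp only [cl, length]; convert un _ _ _ hf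
  | pev f hf => simp only [cl, length]; convert un _ _ _ hf
  | palw f hf => simp only [cl, length]; convert un _ _ _ hf
  | bex c f hf => simp only [cl, length]; convert bd _ _ _ _ hf
  | ball c f hf => simp only [cl, length]; convert bd _ _ _ _ hf

theorem exists_lit_mem_cl (f : NNF S) : ∃ p, lit p ∈ f.cl := by
  induction f with
  | lit p => exact ⟨p, by simp [cl]⟩
  | and f g hf hg | or f g hf hg | untl f g hf hg | rels f g hf hg =>
    obtain ⟨p, hp⟩ := hf
    exact ⟨p, by simp [cl, hp]⟩
  | next f hf | ev f hf | alw f hf | pev f hf | palw f hf | bex c f hf | ball c f hf =>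
    obtain ⟨p, hp⟩ := hf
    exact ⟨p, by simp [cl, hp]⟩

theorem length_le_of_mem_cl {f g : NNF S} (h : g ∈ f.cl) : g.length ≤ f.length := by
  induction f with
  | lit p => simp_all [cl]
  | and f₁ f₂ h₁ h₂ | or f₁ f₂ h₁ h₂ | untl f₁ f₂ h₁ h₂ | rels f₁ f₂ h₁ h₂ =>
    simp only [cl, Finset.mem_insert, Finset.mem_union] at h
    rcases h with rfl | h | h
    · exact le_rfl
    · have := h₁ h; simp only [length]; omega
    · have := h₂ h; simp only [length]; omega
  | next f hf | ev f hf | alw f hf | pev f hf | palw f hf =>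
    simp only [cl, Finset.mem_insert] at h
    rcases h with rfl | h
    · exact le_rfl
    · have := hf h; simp only [length]; omega
  | bex c f hf | ball c f hf =>
    simp only [cl, Finset.mem_union, Finset.mem_image, Finset.mem_range] at h
    rcases h with ⟨k, hk, rfl⟩ | h
    · simp only [length]; omega
    · have := hf h; simp only [length]; omega

theorem pevFree_of_mem_cl {f g : NNF S} (h : g ∈ f.cl) (hf : f.PevFree) : g.PevFree := by
  induction f with
  | lit p => simp_all [cl]
  | and f₁ f₂ h₁ h₂ | or f₁ f₂ h₁ h₂ | untl f₁ f₂ h₁ h₂ | rels f₁ f₂ h₁ h₂ =>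
    simp only [cl, Finset.mem_insert, Finset.mem_union] at h
    rcases h with rfl | h | h
    · exact hf
    · exact h₁ h hf.1
    · exact h₂ h hf.2
  | next f ih | ev f ih | alw f ih | palw f ih =>
    simp only [cl, Finset.mem_insert] at h
    rcases h with rfl | h
    · exact hf
    · exact ih h hf
  | pev f => exact hf.elim
  | bex c f ih | ball c f ih =>
    simp only [cl, Finset.mem_union, Finset.mem_image, Finset.mem_range] at h
    rcases h with ⟨k, hk, rfl⟩ | h
    · exact hf
    · exact ih h hf

theorem palwFree_of_mem_cl {f g : NNF S} (h : g ∈ f.cl) (hf : f.PalwFree) : g.PalwFree := by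
  induction f with
  | lit p => simp_all [cl]
  | and f₁ f₂ h₁ h₂ | or f₁ f₂ h₁ h₂ | untl f₁ f₂ h₁ h₂ | rels f₁ f₂ h₁ h₂ =>
    simp only [cl, Finset.mem_insert, Finset.mem_union] at h
    rcases h with rfl | h | h
    · exact hf
    · exact h₁ h hf.1
    · exact h₂ h hf.2
  | next f ih | ev f ih | alw f ih | pev f ih =>
    simp only [cl, Finset.mem_insert] at h
    rcases h with rfl | h
    · exact hf
    · exact ih h hf
  | palw f => exact hf.elim
  | bex c f ih | ball c f ih =>
    simp only [cl, Finset.mem_union, Finset.mem_image, Finset.mem_range] at h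
    rcases h with ⟨k, hk, rfl⟩ | h
    · exact hf
    · exact ih h hf

end NNF

/-! ### Fair paths -/

/-- A fair path of the graph `E`: whenever the first state of a finite path fragment recurs
infinitely often, so does the whole fragment. The fragment is `u 0, …, u n`. -/
structure Fair {S : Type*} (E : S → S → Prop) (π : ℕ → S) : Prop where
  edge : ∀ i, E (π i) (π (i + 1))
  recur : ∀ (u : ℕ → S) (n : ℕ), (∀ i < n, E (u i) (u (i + 1))) →
    (∃ᶠ i in atTop, π i = u 0) → ∃ᶠ i in atTop, ∀ j ≤ n, π (i + j) = u j

namespace Fair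

variable {S : Type*} {E : S → S → Prop} {π ρ : ℕ → S}

theorem frequently_of_tail {p q : ℕ} (h : ∀ k, ρ (p + k) = π (q + k))
    {P : (ℕ → S) → Prop} (hf : ∃ᶠ i in atTop, P fun k => π (i + k)) :
    ∃ᶠ i in atTop, P fun k => ρ (i + k) := by
  rw [frequently_atTop] at hf ⊢
  intro a
  obtain ⟨b, hb, hP⟩ := hf (q + a)
  refine ⟨p + (b - q), by omega, ?_⟩
  convert hP using 2 with k
  rw [add_assoc, h]
  congr 1
  omega

/-- Fairness is a property of the tail. -/
theorem of_tail (hπ : Fair E π) {p q : ℕ} (h : ∀ k, ρ (p + k) = π (q + k))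
    (he : ∀ i, E (ρ i) (ρ (i + 1))) : Fair E ρ := by
  refine ⟨he, fun u n hu h0 => ?_⟩
  refine frequently_of_tail (P := fun σ => ∀ j ≤ n, σ j = u j) h (hπ.recur u n hu ?_)
  exact frequently_of_tail (P := fun σ => σ 0 = u 0) (fun k => (h k).symm) h0

theorem shift (hπ : Fair E π) (i : ℕ) : Fair E fun k => π (i + k) :=
  hπ.of_tail (p := 0) (q := i) (fun k => by simp) fun k => hπ.edge (i + k)

/-- Replacing the part of a fair path from position `j` on by a fair path. -/
theorem splice (hπ : Fair E π) (hρ : Fair E ρ) {j : ℕ} (h : ρ 0 = π j) :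
    Fair E fun k => if k < j then π k else ρ (k - j) := by
  refine hρ.of_tail (p := j) (q := 0) (fun k => by simp) fun k => ?_
  by_cases h1 : k + 1 < j
  · simpa [h1, (by omega : k < j)] using hπ.edge k
  · by_cases h2 : k < j
    · have h3 : k + 1 = j := by omega
      subst h3
      simpa [h] using hπ.edge k
    · have h3 : k + 1 - j = (k - j) + 1 := by omega
      simpa [h1, h2, h3] using hρ.edge (k - j)

theorem exists_recurrent [Finite S] (π : ℕ → S) (i : ℕ) :
    ∃ n ≥ i, ∃ᶠ k in atTop, π k = π n := by
  by_contra! hc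
  have h1 : ∀ s : S, ∀ᶠ k in atTop, π k ≠ s := by
    intro s
    by_contra h
    have h : ∃ᶠ k in atTop, π k = s := by simpa [Filter.Frequently] using h
    obtain ⟨n, hn, hs⟩ := frequently_atTop.1 h i
    exact h (hs ▸ hc n hn)
  obtain ⟨k, hk⟩ := (eventually_all.2 h1).exists
  exact hk (π k) rfl

end Fair

variable {S : Type*}

/-! ### Certificates -/

open NNF in
/-- The local condition on the sets `T` and `T'` of formulas claimed at two consecutive positions,
the first one at the state `s`, that justifies the claim of a formula at the first position.
A leaf `Lf s f` stands for the fact that `f` holds inevitably and forever from `s` on. The bound in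
`pev` is ignored, and so is `palw`: these involve distant positions. -/
def Local (Lf : S → NNF S → Prop) (s : S) (T T' : Set (NNF S)) : NNF S → Prop
  | lit p => p s
  | .and f g => f ∈ T ∧ g ∈ T
  | .or f g => f ∈ T ∨ g ∈ T
  | next f => f ∈ T'
  | untl f g => g ∈ T ∨ (f ∈ T ∧ untl f g ∈ T')
  | rels f g => (Lf s g ∨ (g ∈ T ∧ f ∈ T)) ∨ (g ∈ T ∧ rels f g ∈ T')
  | ev f => f ∈ T ∨ ev f ∈ T'
  | alw f => Lf s f ∨ (f ∈ T ∧ alw f ∈ T')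
  | bex 0 f => f ∈ T
  | bex (c + 1) f => f ∈ T ∨ bex c f ∈ T'
  | ball 0 f => f ∈ T
  | ball (c + 1) f => f ∈ T ∧ ball c f ∈ T'
  | pev f => f ∈ T ∨ pev f ∈ T'
  | palw _ => True

theorem Local.mono {Lf : S → NNF S → Prop} {s : S} {T T' U U' : Set (NNF S)} (h : T ⊆ U)
    (h' : T' ⊆ U') {f : NNF S} (hf : Local Lf s T T' f) : Local Lf s U U' f := by
  cases f with
  | bex c f => cases c <;> (simp only [Local] at hf ⊢; grind)
  | ball c f => cases c <;> (simp only [Local] at hf ⊢; grind)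
  | _ => simp only [Local] at hf ⊢ <;> grind

/-- A certificate: finitely many claims (formula, position) along `π`, each justified locally.
As there are finitely many, no eventuality can be postponed forever. -/
structure Cert (Lf : S → NNF S → Prop) (π : ℕ → S) (C : ℕ → Set (NNF S)) : Prop where
  loc : ∀ i, ∀ f ∈ C i, Local Lf (π i) (C i) (C (i + 1)) f
  fin : ∃ n, ∀ i ≥ n, C i = ∅

/-- Every claim of `palw f` is justified when the parameter is `N`. -/
def Windows (N : ℕ) (C : ℕ → Set (NNF S)) : Prop :=
  ∀ i f, NNF.palw f ∈ C i → ∀ j ≤ N, f ∈ C (i + j)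

/-- Every claim of `pev f` is justified when the parameter is `N`. -/
def Witnesses (N : ℕ) (C : ℕ → Set (NNF S)) : Prop :=
  ∀ i f, NNF.pev f ∈ C i → ∃ j ≤ N, f ∈ C (i + j)

/-- All fair paths from `s` satisfy `f` at all positions. -/
def Inevitable (E : S → S → Prop) (K : ℕ) (s : S) (f : NNF S) : Prop :=
  ∀ ρ, Fair E ρ → ρ 0 = s → ∀ j, f.Sat K ρ j

theorem exists_of_step {P B D : ℕ → Prop} (hP : ∀ i, P i → B i ∨ (D i ∧ P (i + 1)))
    {n : ℕ} (hn : ∀ i ≥ n, ¬ P i) {i : ℕ} (hi : P i) :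
    ∃ j, B (i + j) ∧ ∀ k < j, D (i + k) := by
  obtain ⟨d, hd⟩ : ∃ d, n ≤ i + d := ⟨n, by omega⟩
  induction d generalizing i with
  | zero => exact (hn i hd hi).elim
  | succ d ih =>
    rcases hP i hi with h | ⟨h, h'⟩
    · exact ⟨0, h, by simp⟩
    · obtain ⟨j, hj, hk⟩ := ih h' (by omega)
      refine ⟨j + 1, by rwa [add_comm j, ← add_assoc], fun k hkj => ?_⟩
      cases k with
      | zero => exact h
      | succ k => rw [add_comm k, ← add_assoc]; exact hk k (by omega)

namespace Cert

variable {E : S → S → Prop} {K : ℕ} {π : ℕ → S} {C : ℕ → Set (NNF S)}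

/-- The claims of a certificate are true. -/
theorem sat (hC : Cert (Inevitable E K) π C) (hW : Windows K C) (hw : Witnesses K C)
    (hπ : Fair E π) {f : NNF S} {i : ℕ} (hf : f ∈ C i) : f.Sat K π i := by
  obtain ⟨n, hn⟩ := hC.fin
  have hn' : ∀ g, ∀ i ≥ n, ¬ g ∈ C i := fun g i hi => by simp [hn i hi]
  have leaf : ∀ i g, Inevitable E K (π i) g → ∀ j, g.Sat K π (i + j) := fun i g h j =>
    (NNF.sat_shift K π i g j).1 (h _ (hπ.shift i) rfl j)
  induction f generalizing i with
  | lit p => exact hC.loc _ _ hf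
  | and f g ihf ihg => exact (hC.loc _ _ hf).imp ihf ihg
  | or f g ihf ihg => exact (hC.loc _ _ hf).imp ihf ihg
  | next f ih => exact ih (hC.loc _ _ hf)
  | untl f g ihf ihg =>
    obtain ⟨j, hj, hk⟩ := exists_of_step (P := fun i => NNF.untl f g ∈ C i)
      (B := fun i => g ∈ C i) (D := fun i => f ∈ C i) (fun i h => hC.loc i _ h) (hn' _) hf
    exact ⟨j, ihg hj, fun k h => ihf (hk k h)⟩
  | rels f g ihf ihg =>
    obtain ⟨j, hj, hk⟩ := exists_of_step (P := fun i => NNF.rels f g ∈ C i)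
      (B := fun i => Inevitable E K (π i) g ∨ (g ∈ C i ∧ f ∈ C i)) (D := fun i => g ∈ C i)
      (fun i h => hC.loc i _ h) (hn' _) hf
    intro l
    rcases lt_or_ge l j with h | h
    · exact .inl (ihg (hk l h))
    rcases hj with hj | ⟨hj, hj'⟩
    · obtain ⟨d, rfl⟩ := Nat.exists_eq_add_of_le h
      rw [← add_assoc]
      exact .inl (leaf _ _ hj d)
    · rcases h.eq_or_lt with rfl | h
      · exact .inl (ihg hj)
      · exact .inr ⟨j, h, ihf hj'⟩
  | ev f ih =>
    obtain ⟨j, hj, -⟩ := exists_of_step (P := fun i => NNF.ev f ∈ C i) (B := fun i => f ∈ C i)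
      (D := fun _ => True) (fun i h => (hC.loc i _ h).imp_right fun h => ⟨trivial, h⟩)
      (hn' (.ev f)) hf
    exact ⟨j, ih hj⟩
  | alw f ih =>
    obtain ⟨j, hj, hk⟩ := exists_of_step (P := fun i => NNF.alw f ∈ C i)
      (B := fun i => Inevitable E K (π i) f) (D := fun i => f ∈ C i)
      (fun i h => hC.loc i _ h) (hn' _) hf
    intro l
    rcases lt_or_ge l j with h | h
    · exact ih (hk l h)
    · obtain ⟨d, rfl⟩ := Nat.exists_eq_add_of_le h
      rw [← add_assoc]
      exact leaf _ _ hj d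
  | bex c f ih =>
    induction c generalizing i with
    | zero => exact ⟨0, le_rfl, ih (hC.loc _ _ hf)⟩
    | succ c ihc =>
      rcases hC.loc _ _ hf with h | h
      · exact ⟨0, by omega, ih h⟩
      · obtain ⟨j, hj, hs⟩ := ihc h
        exact ⟨1 + j, by omega, by rwa [← add_assoc]⟩
  | ball c f ih =>
    induction c generalizing i with
    | zero =>
      intro j hj
      obtain rfl : j = 0 := by omega
      exact ih (hC.loc _ _ hf)
    | succ c ihc =>
      obtain ⟨h, h'⟩ := hC.loc _ _ hf
      intro j hj
      cases j with
      | zero => exact ih h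
      | succ j => rw [add_comm j, ← add_assoc]; exact ihc h' j (by omega)
  | pev f ih =>
    obtain ⟨j, hj, h⟩ := hw _ _ hf
    exact ⟨j, hj, ih h⟩
  | palw f ih => exact fun j hj => ih (hW _ _ hf j hj)

theorem mono_leaf {Lf Lf' : S → NNF S → Prop} (hC : Cert Lf π C)
    (hr : ∀ i f g, NNF.rels f g ∈ C i → Lf (π i) g → Lf' (π i) g)
    (ha : ∀ i f, NNF.alw f ∈ C i → Lf (π i) f → Lf' (π i) f) : Cert Lf' π C := by
  refine ⟨fun i f hf => ?_, hC.fin⟩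
  have h := hC.loc i f hf
  cases f with
  | rels f g => exact h.imp_left fun h => h.imp_left (hr i f g hf)
  | alw f => exact h.imp_left (ha i f hf)
  | bex c f => cases c <;> exact h
  | ball c f => cases c <;> exact h
  | _ => exact h

theorem congr_path {Lf : S → NNF S → Prop} (hC : Cert Lf π C) {ρ : ℕ → S}
    (h : ∀ i, (C i).Nonempty → ρ i = π i) : Cert Lf ρ C :=
  ⟨fun i f hf => by rw [h i ⟨f, hf⟩]; exact hC.loc i f hf, hC.fin⟩

end Cert

/-! ### Existence of certificates -/

/-- A sound certificate for the parameter `K` with claims from `X`. -/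
structure Proof (E : S → S → Prop) (K : ℕ) (π : ℕ → S) (X : Set (NNF S))
    (C : ℕ → Set (NNF S)) : Prop where
  cert : Cert (Inevitable E K) π C
  windows : Windows K C
  witnesses : Witnesses K C
  sub : ∀ i, C i ⊆ X

/-- The claim of `f` at position `i` belongs to a sound certificate with claims from `X`. -/
def Provable (E : S → S → Prop) (K : ℕ) (π : ℕ → S) (X : Set (NNF S)) (f : NNF S) (i : ℕ) : Prop :=
  ∃ C, Proof E K π X C ∧ f ∈ C i

namespace Proof

variable {E : S → S → Prop} {K : ℕ} {π : ℕ → S} {X Y : Set (NNF S)} {C D : ℕ → Set (NNF S)}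

theorem empty : Proof E K π X fun _ => ∅ :=
  ⟨⟨by simp, 0, by simp⟩, by simp [Windows], by simp [Witnesses], by simp⟩

theorem union (hC : Proof E K π X C) (hD : Proof E K π X D) :
    Proof E K π X fun i => C i ∪ D i := by
  obtain ⟨n, hn⟩ := hC.cert.fin
  obtain ⟨m, hm⟩ := hD.cert.fin
  refine ⟨⟨?_, max n m, fun i hi => ?_⟩, ?_, ?_, fun i => Set.union_subset (hC.sub i) (hD.sub i)⟩
  · rintro i f (hf | hf)
    · exact (hC.cert.loc i f hf).mono Set.subset_union_left Set.subset_union_left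
    · exact (hD.cert.loc i f hf).mono Set.subset_union_right Set.subset_union_right
  · rw [hn i (by omega), hm i (by omega), Set.union_empty]
  · rintro i f (hf | hf) j hj
    · exact .inl (hC.windows i f hf j hj)
    · exact .inr (hD.windows i f hf j hj)
  · rintro i f (hf | hf)
    · obtain ⟨j, hj, h⟩ := hC.witnesses i f hf
      exact ⟨j, hj, .inl h⟩
    · obtain ⟨j, hj, h⟩ := hD.witnesses i f hf
      exact ⟨j, hj, .inr h⟩

/-- Adding one claim that is justified by the present ones. -/
theorem intro (hC : Proof E K π X C) {f : NNF S} {i : ℕ} (hf : f ∈ X)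
    (hl : Local (Inevitable E K) (π i) (C i) (C (i + 1)) f)
    (hW : ∀ g, f = .palw g → ∀ j ≤ K, g ∈ C (i + j))
    (hw : ∀ g, f = .pev g → ∃ j ≤ K, g ∈ C (i + j)) : Provable E K π X f i := by
  obtain ⟨n, hn⟩ := hC.cert.fin
  refine ⟨fun k => C k ∪ {g | g = f ∧ k = i}, ⟨⟨?_, max n (i + 1), fun k hk => ?_⟩, ?_, ?_, ?_⟩,
    .inr ⟨rfl, rfl⟩⟩
  · rintro k g (hg | ⟨rfl, rfl⟩)
    · exact (hC.cert.loc k g hg).mono Set.subset_union_left Set.subset_union_left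
    · exact hl.mono Set.subset_union_left Set.subset_union_left
  · rw [hn k (by omega)]
    ext g
    simp only [Set.empty_union, Set.mem_ofPred_eq, Set.mem_empty_iff_false, iff_false, not_and]
    omega
  · rintro k g (hg | ⟨h, rfl⟩) j hj
    · exact .inl (hC.windows k g hg j hj)
    · exact .inl (hW g h.symm j hj)
  · rintro k g (hg | ⟨h, rfl⟩)
    · obtain ⟨j, hj, h⟩ := hC.witnesses k g hg
      exact ⟨j, hj, .inl h⟩
    · obtain ⟨j, hj, h⟩ := hw g h.symm
      exact ⟨j, hj, .inl h⟩
  · rintro k g (hg | ⟨rfl, rfl⟩)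
    · exact hC.sub k hg
    · exact hf

end Proof

namespace Provable

variable {E : S → S → Prop} {K : ℕ} {π : ℕ → S} {X Y : Set (NNF S)} {f g : NNF S} {i j : ℕ}

theorem mono (h : Provable E K π X f i) (hXY : X ⊆ Y) : Provable E K π Y f i :=
  let ⟨C, hC, hf⟩ := h
  ⟨C, ⟨hC.cert, hC.windows, hC.witnesses, fun i => (hC.sub i).trans hXY⟩, hf⟩

theorem pair (hf : Provable E K π X f i) (hg : Provable E K π X g j) :
    ∃ C, Proof E K π X C ∧ f ∈ C i ∧ g ∈ C j := by
  obtain ⟨C, hC, hf⟩ := hf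
  obtain ⟨D, hD, hg⟩ := hg
  exact ⟨_, hC.union hD, .inl hf, .inr hg⟩

theorem range (n : ℕ) (h : ∀ j ≤ n, Provable E K π X f (i + j)) :
    ∃ C, Proof E K π X C ∧ ∀ j ≤ n, f ∈ C (i + j) := by
  induction n with
  | zero =>
    obtain ⟨C, hC, hf⟩ := h 0 le_rfl
    refine ⟨C, hC, fun j hj => ?_⟩
    obtain rfl : j = 0 := by omega
    exact hf
  | succ n ih =>
    obtain ⟨C, hC, hf⟩ := ih fun j hj => h j (by omega)
    obtain ⟨D, hD, hg⟩ := h (n + 1) le_rfl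
    refine ⟨_, hC.union hD, fun j hj => ?_⟩
    rcases Nat.le_succ_iff.1 hj with hj | rfl
    · exact .inl (hf j hj)
    · exact .inr hg

/-- A provable formula is true on all fair paths with the same prefix of a certain length. -/
theorem determined (h : Provable E K π X f i) :
    ∃ n, ∀ ρ, Fair E ρ → (∀ k ≤ n, ρ k = π k) → f.Sat K ρ i := by
  obtain ⟨C, hC, hf⟩ := h
  obtain ⟨n, hn⟩ := hC.cert.fin
  refine ⟨n, fun ρ hρ heq => Cert.sat (hC.cert.congr_path fun k hk => heq k ?_)
    hC.windows hC.witnesses hρ hf⟩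
  by_contra hlt
  simp [hn k (by omega)] at hk

end Provable

/-- If the truth of `g.neg` is always witnessed by a finite prefix, then a formula `g` true from
position `i` on along a fair path is eventually inevitable: a violation possible from a recurrent
state would occur infinitely often. -/
theorem Fair.exists_inevitable [Finite S] {E : S → S → Prop} {K : ℕ} {π : ℕ → S} (hπ : Fair E π)
    {g : NNF S} {X : Set (NNF S)}
    (hg : ∀ ρ, Fair E ρ → ∀ j, g.neg.Sat K ρ j → Provable E K ρ X g.neg j)
    {i : ℕ} (h : ∀ j, g.Sat K π (i + j)) : ∃ d, Inevitable E K (π (i + d)) g := by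
  obtain ⟨m, hm, hrec⟩ := Fair.exists_recurrent π i
  refine ⟨m - i, ?_⟩
  rw [Nat.add_sub_cancel' hm]
  intro ρ hρ h0 j
  by_contra hj
  obtain ⟨n, hn⟩ := (hg ρ hρ j ((NNF.sat_neg ..).2 hj)).determined
  obtain ⟨p, hp, hpe⟩ := frequently_atTop.1
    (hπ.recur ρ n (fun k _ => hρ.edge k) (by simpa [h0] using hrec)) i
  have h1 := (NNF.sat_shift K π p g.neg j).1 (hn _ (hπ.shift p) fun k hk => hpe k hk)
  rw [NNF.sat_neg] at h1
  obtain ⟨d, hd⟩ := Nat.exists_eq_add_of_le (show i ≤ p + j by omega)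
  exact h1 (hd ▸ h d)

/-- Every true formula has a certificate. -/
theorem Fair.provable [Finite S] {E : S → S → Prop} {K : ℕ} {π : ℕ → S} (hπ : Fair E π)
    {f : NNF S} {i : ℕ} (hf : f.Sat K π i) : Provable E K π f.cl f i := by
  induction hL : f.length using Nat.strong_induction_on generalizing f π i with
  | _ L ih =>
  have ih' : ∀ g : NNF S, g.length < f.length → g.cl ⊆ f.cl →
      ∀ i, g.Sat K π i → Provable E K π f.cl g i := fun g hlt hsub i hg =>
    (ih g.length (hL ▸ hlt) hπ hg rfl).mono (by exact_mod_cast hsub)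
  -- `g` and `g.neg` have the same length, so the hypothesis also covers the negation of an operand
  have inev : ∀ g : NNF S, g.length < f.length → ∀ i, (∀ j, g.Sat K π (i + j)) →
      ∃ d, Inevitable E K (π (i + d)) g := fun g hlt i hg =>
    hπ.exists_inevitable (X := (g.neg.cl : Set (NNF S)))
      (fun ρ hρ j hj => ih g.neg.length (by rw [NNF.length_neg]; omega) hρ hj rfl) hg
  have self : f ∈ (f.cl : Set (NNF S)) := f.self_mem_cl
  clear ih hL
  cases f with
  | lit p => exact Proof.empty.intro self hf (by simp) (by simp)
  | and f g =>
    obtain ⟨C, hC, h1, h2⟩ := (ih' f (by simp +arith [NNF.length])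
      (fun x hx => by simp [NNF.cl, hx]) i hf.1).pair
      (ih' g (by simp +arith [NNF.length]) (fun x hx => by simp [NNF.cl, hx]) i hf.2)
    exact hC.intro self ⟨h1, h2⟩ (by simp) (by simp)
  | or f g =>
    rcases hf with hf | hf
    · obtain ⟨C, hC, h⟩ := ih' f (by simp +arith [NNF.length])
        (fun x hx => by simp [NNF.cl, hx]) i hf
      exact hC.intro self (.inl h) (by simp) (by simp)
    · obtain ⟨C, hC, h⟩ := ih' g (by simp +arith [NNF.length])
        (fun x hx => by simp [NNF.cl, hx]) i hf
      exact hC.intro self (.inr h) (by simp) (by simp)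
  | next f =>
    obtain ⟨C, hC, h⟩ := ih' f (by simp [NNF.length]) (fun x hx => by simp [NNF.cl, hx]) _ hf
    exact hC.intro self h (by simp) (by simp)
  | untl f g =>
    obtain ⟨j, hj, hk⟩ := hf
    induction j generalizing i with
    | zero =>
      obtain ⟨C, hC, h⟩ := ih' g (by simp +arith [NNF.length])
          (fun x hx => by simp [NNF.cl, hx]) i hj
      exact hC.intro self (.inl h) (by simp) (by simp)
    | succ j ihj =>
      have h1 := ihj (i := i + 1) (by rwa [add_assoc, add_comm 1])
        fun k hkj => by rw [add_assoc, add_comm 1]; exact hk (k + 1) (by omega)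
      obtain ⟨C, hC, h1, h2⟩ := h1.pair
        (ih' f (by simp +arith [NNF.length]) (fun x hx => by simp [NNF.cl, hx]) i (hk 0 (by omega)))
      exact hC.intro self (.inr ⟨h2, h1⟩) (by simp) (by simp)
  | rels f g =>
    have hg := ih' g (by simp +arith [NNF.length]) (fun x hx => by simp [NNF.cl, hx])
    have hf' := ih' f (by simp +arith [NNF.length]) (fun x hx => by simp [NNF.cl, hx])
    by_cases h : ∀ j, g.Sat K π (i + j)
    · obtain ⟨d, hd⟩ := inev g (by simp +arith [NNF.length]) i h
      induction d generalizing i with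
      | zero => exact Proof.empty.intro self (.inl (.inl hd)) (by simp) (by simp)
      | succ d ihd =>
        have hs : ∀ j, g.Sat K π (i + 1 + j) := fun j => by
          rw [add_assoc, add_comm 1]; exact h (j + 1)
        have h1 := ihd (i := i + 1) (fun j => .inl (hs j)) hs
          (by rwa [add_assoc, add_comm 1])
        obtain ⟨C, hC, h1, h2⟩ := h1.pair (hg i (h 0))
        exact hC.intro self (.inr ⟨h2, h1⟩) (by simp) (by simp)
    · push Not at h
      obtain ⟨j, hj⟩ := h
      obtain ⟨k, -, hk⟩ := (hf j).resolve_left hj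
      clear hj j
      induction k using Nat.strong_induction_on generalizing i with
      | _ k ihk =>
      by_cases h0 : f.Sat K π i
      · obtain ⟨C, hC, h1, h2⟩ := (hf' i h0).pair (hg i ((hf 0).resolve_right (by simp)))
        exact hC.intro self (.inl (.inr ⟨h2, h1⟩)) (by simp) (by simp)
      · cases k with
        | zero => exact (h0 hk).elim
        | succ k =>
          have h1 := ihk k (by omega) (i := i + 1) (fun j => by
            rw [add_assoc, add_comm 1]
            refine (hf (j + 1)).imp_right ?_
            rintro ⟨l, hl, hs⟩
            cases l with
            | zero => exact (h0 hs).elim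
            | succ l => exact ⟨l, by omega, by rwa [add_assoc, add_comm 1]⟩)
            (by rwa [add_assoc, add_comm 1])
          obtain ⟨C, hC, h1, h2⟩ := h1.pair (hg i ((hf 0).resolve_right (by simp)))
          exact hC.intro self (.inr ⟨h2, h1⟩) (by simp) (by simp)
  | ev f =>
    obtain ⟨j, hj⟩ := hf
    induction j generalizing i with
    | zero =>
      obtain ⟨C, hC, h⟩ := ih' f (by simp [NNF.length]) (fun x hx => by simp [NNF.cl, hx]) i hj
      exact hC.intro self (.inl h) (by simp) (by simp)
    | succ j ihj =>
      obtain ⟨C, hC, h⟩ := ihj (i := i + 1) (by rwa [add_assoc, add_comm 1])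
      exact hC.intro self (.inr h) (by simp) (by simp)
  | alw f =>
    obtain ⟨d, hd⟩ := inev f (by simp [NNF.length]) i hf
    induction d generalizing i with
    | zero => exact Proof.empty.intro self (.inl hd) (by simp) (by simp)
    | succ d ihd =>
      have h1 := ihd (i := i + 1)
        (fun j => by rw [add_assoc, add_comm 1]; exact hf (j + 1))
        (by rwa [add_assoc, add_comm 1])
      obtain ⟨C, hC, h1, h2⟩ := h1.pair
        (ih' f (by simp [NNF.length]) (fun x hx => by simp [NNF.cl, hx]) i (hf 0))
      exact hC.intro self (.inr ⟨h2, h1⟩) (by simp) (by simp)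
  | bex c f =>
    have hf' := ih' f (by simp +arith [NNF.length]) (fun x hx => by simp [NNF.cl, hx])
    have key : ∀ c' ≤ c, ∀ i, (NNF.bex c' f).Sat K π i →
        Provable E K π (NNF.bex c f).cl (.bex c' f) i := by
      intro c'
      induction c' with
      | zero =>
        rintro hc i ⟨j, hj, hs⟩
        obtain rfl : j = 0 := by omega
        obtain ⟨C, hC, h⟩ := hf' i hs
        exact hC.intro (by simp [NNF.cl]) h (by simp) (by simp)
      | succ c' ihc =>
        rintro hc i ⟨j, hj, hs⟩
        have hX : NNF.bex (c' + 1) f ∈ ((NNF.bex c f).cl : Set (NNF S)) := by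
          simp [NNF.cl]; omega
        cases j with
        | zero =>
          obtain ⟨C, hC, h⟩ := hf' i hs
          exact hC.intro hX (.inl h) (by simp) (by simp)
        | succ j =>
          obtain ⟨C, hC, h⟩ := ihc (by omega) (i + 1)
            ⟨j, by omega, by rwa [add_assoc, add_comm 1]⟩
          exact hC.intro hX (.inr h) (by simp) (by simp)
    exact key c le_rfl i hf
  | ball c f =>
    have hf' := ih' f (by simp +arith [NNF.length]) (fun x hx => by simp [NNF.cl, hx])
    have key : ∀ c' ≤ c, ∀ i, (NNF.ball c' f).Sat K π i →
        Provable E K π (NNF.ball c f).cl (.ball c' f) i := by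
      intro c'
      induction c' with
      | zero =>
        intro hc i hs
        obtain ⟨C, hC, h⟩ := hf' i (hs 0 le_rfl)
        exact hC.intro (by simp [NNF.cl]) h (by simp) (by simp)
      | succ c' ihc =>
        intro hc i hs
        have h1 := ihc (by omega) (i + 1) fun j hj => by
          rw [add_assoc, add_comm 1]; exact hs (j + 1) (by omega)
        obtain ⟨C, hC, h1, h2⟩ := h1.pair (hf' i (hs 0 (by omega)))
        exact hC.intro (by simp [NNF.cl]; omega) ⟨h2, h1⟩ (by simp) (by simp)
    exact key c le_rfl i hf
  | pev f =>
    obtain ⟨j, hjK, hj⟩ := hf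
    have key : ∀ j ≤ K, ∀ i, f.Sat K π (i + j) →
        ∃ C, Proof E K π (NNF.pev f).cl C ∧ NNF.pev f ∈ C i ∧ f ∈ C (i + j) := by
      intro j
      induction j with
      | zero =>
        intro _ i hj
        obtain ⟨C, hC, h⟩ := ih' f (by simp [NNF.length]) (fun x hx => by simp [NNF.cl, hx]) i hj
        exact (hC.intro self (.inl h) (by simp) (by simp; exact ⟨0, by omega, h⟩)).pair ⟨C, hC, h⟩
      | succ j ihj =>
        intro hjK i hj
        obtain ⟨C, hC, h, h'⟩ := ihj (by omega) (i + 1) (by rwa [add_assoc, add_comm 1])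
        rw [add_assoc, add_comm 1] at h'
        exact (hC.intro self (.inr h) (by simp) (by simp; exact ⟨j + 1, hjK, h'⟩)).pair ⟨C, hC, h'⟩
    obtain ⟨C, hC, h, -⟩ := key j hjK i hj
    exact ⟨C, hC, h⟩
  | palw f =>
    obtain ⟨C, hC, h⟩ := Provable.range K fun j hj =>
      ih' f (by simp [NNF.length]) (fun x hx => by simp [NNF.cl, hx]) (i + j) (hf j hj)
    exact hC.intro self trivial (by simp; exact h) (by simp)

/-! ### Pumping -/

/-- A time change `g` that looks like a successor step to states and claims preserves
certificates. -/
theorem Cert.reindex {Lf : S → NNF S → Prop} {π : ℕ → S} {C : ℕ → Set (NNF S)}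
    (hC : Cert Lf π C) (g : ℕ → ℕ) (hg : ∀ i, C (g (i + 1)) = C (g i + 1))
    (hlim : ∀ n, ∃ m, ∀ i ≥ m, n ≤ g i) : Cert Lf (fun i => π (g i)) fun i => C (g i) := by
  obtain ⟨n, hn⟩ := hC.fin
  obtain ⟨m, hm⟩ := hlim n
  exact ⟨fun i f hf => by rw [hg]; exact hC.loc _ f hf, m, fun i hi => hn _ (hm i hi)⟩

/-- The claims of some `palw f` whose windows do not extend by one more position, given by the
position and the operand `f`. -/
def tight (N : ℕ) (C : ℕ → Set (NNF S)) : Set (ℕ × NNF S) :=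
  {q | NNF.palw q.2 ∈ C q.1 ∧ q.2 ∉ C (q.1 + (N + 1))}

theorem finite_tight {N : ℕ} {C : ℕ → Set (NNF S)} {X : Finset (NNF S)} (hW : Windows N C)
    (hfin : ∃ n, ∀ i ≥ n, C i = ∅) (hX : ∀ i, C i ⊆ X) : (tight N C).Finite := by
  obtain ⟨n, hn⟩ := hfin
  refine ((Set.finite_Iio n).prod X.finite_toSet).subset fun q hq => ⟨?_, ?_⟩
  · by_contra h
    have h := hq.1
    rw [hn q.1 (by simp_all)] at h
    exact h
  · exact hX q.1 (hW _ _ hq.1 0 (by omega))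

theorem windows_succ {N : ℕ} {C : ℕ → Set (NNF S)} (hW : Windows N C) (h : tight N C = ∅) :
    Windows (N + 1) C := by
  intro i f hf j hj
  rcases Nat.le_succ_iff.1 hj with hj | rfl
  · exact hW i f hf j hj
  · by_contra hc
    have : (i, f) ∈ tight N C := ⟨hf, hc⟩
    simp [h] at this

/-- A long window of `palw χ` claimed at `p` contains two positions `a < b` with the same state and
the same claims such that no window starts between them in a way that would break if the segment
from `a` to `b` were repeated. -/
theorem exists_pumpable [Fintype S] {N : ℕ} {π : ℕ → S} {C : ℕ → Set (NNF S)} {X : Finset (NNF S)}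
    {l : ℕ} (hl : X.card ≤ l) (hN : Fintype.card S * l * 2 ^ l ≤ N) {φ : S → Prop}
    (hlit : NNF.lit φ ∈ X) (hW : Windows N C) (hX : ∀ i, C i ⊆ X) {p : ℕ} {χ : NNF S}
    (hp : NNF.palw χ ∈ C p) :
    ∃ a b, p < a ∧ a < b ∧ b ≤ p + N ∧ π a = π b ∧ C a = C b ∧
      ∀ g q, a < q → q ≤ b → NNF.palw g ∈ C q → ∀ r, a ≤ r → r < q → g ∈ C r := by
  classical
  -- `St i`: the formulas `palw g` that are claimed in `(p, i]` and whose operand is not claimed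
  -- throughout since `p`. As `i` runs through the window, this set can only grow.
  let Y : Finset (NNF S) := X.filter fun f => (∃ g, f = .palw g) ∧ f ≠ .palw χ
  let St : ℕ → Finset (NNF S) := fun i => Y.filter fun f =>
    ∃ j, p < j ∧ j ≤ i ∧ f ∈ C j ∧ ∃ g, f = .palw g ∧ ∃ r, p ≤ r ∧ r < j ∧ g ∉ C r
  have hSt : ∀ {i j}, i ≤ j → St i ⊆ St j := by
    intro i j hij f hf
    simp only [St, Finset.mem_filter] at hf ⊢
    obtain ⟨hY, k, h1, h2, h3⟩ := hf
    exact ⟨hY, k, h1, by omega, h3⟩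
  have hχX : NNF.palw χ ∈ X := by exact_mod_cast hX p hp
  have hY : Y.card + 2 ≤ X.card := by
    have hsub : Y ⊆ (X.erase (.lit φ)).erase (.palw χ) := by
      intro f hf
      simp only [Y, Finset.mem_filter] at hf
      obtain ⟨h1, ⟨g, rfl⟩, h2⟩ := hf
      simp [h1, h2]
    have h1 := Finset.card_le_card hsub
    have h2 : NNF.palw χ ∈ X.erase (.lit φ) := by simp [hχX]
    have h3 := Finset.card_erase_add_one h2
    have h4 := Finset.card_erase_add_one hlit
    omega
  let code : ℕ → S × Finset (NNF S) × ℕ := fun i => (π i, X.filter (· ∈ C i), (St i).card)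
  let T : Finset (S × Finset (NNF S) × ℕ) :=
    Finset.univ ×ˢ X.powerset ×ˢ Finset.range (Y.card + 1)
  have hpos : 0 < Fintype.card S := Fintype.card_pos_iff.2 ⟨π 0⟩
  have hcard : T.card < (Finset.Icc (p + 1) (p + N)).card := by
    have h1 : T.card = Fintype.card S * (2 ^ X.card * (Y.card + 1)) := by
      simp [T, Finset.card_product, Finset.card_powerset]
    have h2 : 2 ^ X.card * (Y.card + 1) < l * 2 ^ l := by
      calc 2 ^ X.card * (Y.card + 1) ≤ 2 ^ l * (Y.card + 1) := by gcongr; norm_num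
        _ < 2 ^ l * l := by gcongr; omega
        _ = l * 2 ^ l := mul_comm _ _
    rw [h1, Nat.card_Icc]
    calc _ < Fintype.card S * (l * 2 ^ l) := by gcongr
      _ ≤ N := by rwa [← mul_assoc]
      _ = _ := by omega
  have hmaps : ∀ i ∈ Finset.Icc (p + 1) (p + N), code i ∈ T := by
    intro i _
    simp only [code, T, Finset.mem_product, Finset.mem_univ, true_and, Finset.mem_powerset,
      Finset.mem_range, Nat.lt_succ_iff]
    exact ⟨Finset.filter_subset _ _, Finset.card_le_card (Finset.filter_subset _ _)⟩
  obtain ⟨a, ha, b, hb, hne, heq⟩ :=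
    Finset.exists_ne_map_eq_of_card_lt_of_maps_to hcard hmaps
  wlog hab : a < b generalizing a b
  · exact this b hb a ha hne.symm heq.symm (by omega)
  rw [Finset.mem_Icc] at ha hb
  simp only [code, Prod.mk.injEq] at heq
  obtain ⟨h1, h2, h3⟩ := heq
  have hCab : C a = C b := by
    ext f
    have := Finset.ext_iff.1 h2 f
    simp only [Finset.mem_filter] at this
    exact ⟨fun h => (this.1 ⟨by exact_mod_cast hX a h, h⟩).2,
      fun h => (this.2 ⟨by exact_mod_cast hX b h, h⟩).2⟩
  have hStab : St a = St b := Finset.eq_of_subset_of_card_le (hSt hab.le) h3.ge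
  refine ⟨a, b, by omega, hab, by omega, h1, hCab, fun g q haq hqb hg r har hrq => ?_⟩
  by_cases hgχ : g = χ
  · subst hgχ
    have := hW p g hp (r - p) (by omega)
    rwa [Nat.add_sub_cancel' (by omega)] at this
  by_contra hr
  have hmem : NNF.palw g ∈ St b := by
    simp only [St, Y, Finset.mem_filter]
    exact ⟨⟨by exact_mod_cast hX q hg, ⟨g, rfl⟩, by simpa using hgχ⟩, q, by omega, hqb, hg, g, rfl,
      r, by omega, hrq, hr⟩
  rw [← hStab] at hmem
  simp only [St, Finset.mem_filter] at hmem
  obtain ⟨-, j, hpj, hja, hj, -⟩ := hmem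
  have := hW j g hj (r - j) (by omega)
  rw [Nat.add_sub_cancel' (by omega)] at this
  exact hr this

/-- Repeating a segment `[a, b)` once lengthens a tight window and creates no new tight one. -/
theorem exists_fewer_tight [Fintype S] {E : S → S → Prop} {N : ℕ} {Lf : S → NNF S → Prop}
    {π : ℕ → S} {C : ℕ → Set (NNF S)} {X : Finset (NNF S)} {l : ℕ} (hl : X.card ≤ l)
    (hN : Fintype.card S * l * 2 ^ l ≤ N) {φ : S → Prop} (hlit : NNF.lit φ ∈ X)
    (hπ : Fair E π) (hC : Cert Lf π C) (hW : Windows N C) (hX : ∀ i, C i ⊆ X)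
    (hne : (tight N C).Nonempty) :
    ∃ (ρ : ℕ → S) (D : ℕ → Set (NNF S)), Fair E ρ ∧ ρ 0 = π 0 ∧ Cert Lf ρ D ∧ Windows N D ∧
      (∀ i, D i ⊆ X) ∧ D 0 = C 0 ∧ (tight N D).ncard < (tight N C).ncard := by
  obtain ⟨⟨p, χ⟩, hp⟩ := hne
  obtain ⟨a, b, hpa, hab, hbN, hs, hc, hpump⟩ :=
    exists_pumpable (π := π) hl hN hlit hW hX hp.1
  let g : ℕ → ℕ := fun i => if i < b then i else i - (b - a)
  have g_lt : ∀ {i}, i < b → g i = i := fun h => if_pos h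
  have g_ge : ∀ {i}, b ≤ i → g i = i - (b - a) := fun h => if_neg (by omega)
  have hstep : ∀ {α : Type _} (h : ℕ → α), h a = h b → ∀ i, h (g (i + 1)) = h (g i + 1) := by
    intro α h hh i
    rcases lt_trichotomy (i + 1) b with hi | hi | hi
    · rw [g_lt hi, g_lt (by omega)]
    · rw [g_ge hi.ge, g_lt (by omega), hi, ← hh]
      congr 1
      omega
    · rw [g_ge hi.le, g_ge (by omega)]
      congr 1
      omega
  -- a window starting inside the repeated segment covers the part of the segment before it, too
  have hback : ∀ f q, a ≤ q → q < b → NNF.palw f ∈ C q → ∀ r, a ≤ r → r < b → f ∈ C r := by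
    intro f q haq hqb hf r har hrb
    rcases lt_or_ge r q with h | h
    · exact hpump f q (by omega) hqb.le hf r har h
    · have := hW q f hf (r - q) (by omega)
      rwa [Nat.add_sub_cancel' h] at this
  have hwin : ∀ i f, NNF.palw f ∈ C (g i) → ∀ j ≤ N, f ∈ C (g (i + j)) := by
    intro i f hf j hj
    rcases lt_or_ge i b with hi | hi
    · rw [g_lt hi] at hf
      rcases lt_or_ge (g (i + j)) i with h | h
      · have hb : b ≤ i + j := by
          by_contra hcon
          rw [g_lt (by omega)] at h
          omega
        have := g_ge hb
        exact hback f i (by omega) hi hf _ (by omega) (by omega)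
      · have h' : g (i + j) ≤ i + j := by simp only [g]; split_ifs <;> omega
        have := hW i f hf (g (i + j) - i) (by omega)
        rwa [Nat.add_sub_cancel' h] at this
    · rw [g_ge hi] at hf
      rw [g_ge (by omega)]
      convert hW _ f hf j hj using 2
      omega
  have htight : ∀ i f, (i, f) ∈ tight N (fun i => C (g i)) →
      (g i, f) ∈ tight N C ∧ (i < p ∨ b ≤ i) := by
    rintro i f ⟨hf, hf'⟩
    simp only at hf hf'
    rcases lt_or_ge i b with hi | hi
    · rw [g_lt hi] at hf ⊢
      have hlt : i + (N + 1) < b := by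
        by_contra hcon
        have hg := g_ge (i := i + (N + 1)) (by omega)
        rcases lt_or_ge (g (i + (N + 1))) i with h | h
        · exact hf' (hback f i (by omega) hi hf _ (by omega) (by omega))
        · have := hW i f hf (g (i + (N + 1)) - i) (by omega)
          rw [Nat.add_sub_cancel' h] at this
          exact hf' this
      rw [g_lt hlt] at hf'
      exact ⟨⟨hf, hf'⟩, .inl (by omega)⟩
    · refine ⟨⟨hf, ?_⟩, .inr hi⟩
      rw [g_ge (by omega)] at hf'
      rw [g_ge hi]
      convert hf' using 3
      simp only
      omega
  refine ⟨fun i => π (g i), fun i => C (g i), ?_, ?_, ?_, hwin, fun i => hX _, ?_, ?_⟩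
  · refine hπ.of_tail (p := b) (q := a) (fun k => ?_) fun i => ?_
    · rw [g_ge (by omega)]
      congr 1
      omega
    · rw [hstep π hs]
      exact hπ.edge _
  · simp only [g_lt (show 0 < b by omega)]
  · exact hC.reindex g (hstep C hc) fun n => ⟨n + b, fun i hi => by
      rw [g_ge (by omega)]; omega⟩
  · simp only [g_lt (show 0 < b by omega)]
  · have hfin := finite_tight hW hC.fin hX
    refine lt_of_le_of_lt ?_ (Set.ncard_sdiff_singleton_lt_of_mem hp hfin)
    refine Set.ncard_le_ncard_of_injOn (fun q => (g q.1, q.2)) ?_ ?_ hfin.sdiff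
    · rintro ⟨i, f⟩ hi
      obtain ⟨h1, h2⟩ := htight i f hi
      refine ⟨h1, fun h => ?_⟩
      have h3 : g i = p := congrArg Prod.fst h
      rcases h2 with h2 | h2
      · rw [g_lt (by omega)] at h3; omega
      · rw [g_ge h2] at h3; omega
    · rintro ⟨i, f⟩ hi ⟨j, f'⟩ hj h
      obtain ⟨-, h2⟩ := htight i f hi
      obtain ⟨-, h2'⟩ := htight j f' hj
      simp only [Prod.mk.injEq] at h ⊢
      refine ⟨?_, h.2⟩
      have h := h.1
      rcases h2 with h2 | h2 <;> rcases h2' with h2' | h2'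
      · rwa [g_lt (by omega), g_lt (by omega)] at h
      · rw [g_lt (by omega), g_ge h2'] at h; omega
      · rw [g_ge h2, g_lt (by omega)] at h; omega
      · rw [g_ge h2, g_ge h2'] at h; omega

/-- Beyond the bound, all windows of a certificate can be made longer by pumping. -/
theorem exists_longer_windows [Fintype S] {E : S → S → Prop} {N : ℕ} {Lf : S → NNF S → Prop}
    {π : ℕ → S} {C : ℕ → Set (NNF S)} {X : Finset (NNF S)} {l : ℕ} (hl : X.card ≤ l)
    (hN : Fintype.card S * l * 2 ^ l ≤ N) {φ : S → Prop} (hlit : NNF.lit φ ∈ X)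
    (hπ : Fair E π) (hC : Cert Lf π C) (hW : Windows N C) (hX : ∀ i, C i ⊆ X) :
    ∃ (ρ : ℕ → S) (D : ℕ → Set (NNF S)), Fair E ρ ∧ ρ 0 = π 0 ∧ Cert Lf ρ D ∧
      Windows (N + 1) D ∧ (∀ i, D i ⊆ X) ∧ D 0 = C 0 := by
  induction hn : (tight N C).ncard using Nat.strong_induction_on generalizing π C with
  | _ n ih =>
  rcases (tight N C).eq_empty_or_nonempty with h | h
  · exact ⟨π, C, hπ, rfl, hC, windows_succ hW h, hX, rfl⟩
  · obtain ⟨ρ, D, hρ, h0, hD, hWD, hXD, hD0, hlt⟩ :=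
      exists_fewer_tight hl hN hlit hπ hC hW hX h
    obtain ⟨ρ', D', hρ', h0', hD', hWD', hXD', hD0'⟩ := ih _ (hn ▸ hlt) hρ hD hWD hXD rfl
    exact ⟨ρ', D', hρ', h0'.trans h0, hD', hWD', hXD', hD0'.trans hD0⟩

/-- Removing segments between two positions with the same state and the same claims, a certificate
can be made shorter than the number of pairs of a state and a set of claims. -/
theorem exists_short_cert [Fintype S] {E : S → S → Prop} {Lf : S → NNF S → Prop}
    {π : ℕ → S} {C : ℕ → Set (NNF S)} {X : Finset (NNF S)}
    (hπ : Fair E π) (hC : Cert Lf π C) (hX : ∀ i, C i ⊆ X) :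
    ∃ (ρ : ℕ → S) (D : ℕ → Set (NNF S)), Fair E ρ ∧ ρ 0 = π 0 ∧ Cert Lf ρ D ∧
      (∀ i, D i ⊆ X) ∧ D 0 = C 0 ∧ ∀ i ≥ Fintype.card S * 2 ^ X.card, D i = ∅ := by
  classical
  obtain ⟨n, hn⟩ := hC.fin
  induction n using Nat.strong_induction_on generalizing π C with
  | _ n ih =>
  rcases le_or_gt n (Fintype.card S * 2 ^ X.card) with h | h
  · exact ⟨π, C, hπ, rfl, hC, hX, rfl, fun i hi => hn i (by omega)⟩
  let code : ℕ → S × Finset (NNF S) := fun i => (π i, X.filter (· ∈ C i))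
  have hcard : (Finset.univ ×ˢ X.powerset : Finset (S × Finset (NNF S))).card <
      (Finset.range n).card := by
    simpa [Finset.card_product, Finset.card_powerset] using h
  obtain ⟨a, ha, b, hb, hne, heq⟩ :=
    Finset.exists_ne_map_eq_of_card_lt_of_maps_to (f := code) hcard
      fun i _ => Finset.mem_product.2
      ⟨Finset.mem_univ _, Finset.mem_powerset.2 (Finset.filter_subset _ _)⟩
  wlog hab : a < b generalizing a b
  · exact this b hb a ha hne.symm heq.symm (by omega)
  rw [Finset.mem_range] at ha hb
  simp only [code, Prod.mk.injEq] at heq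
  obtain ⟨hs, h2⟩ := heq
  have hc : C a = C b := by
    ext f
    have := Finset.ext_iff.1 h2 f
    simp only [Finset.mem_filter] at this
    exact ⟨fun h => (this.1 ⟨by exact_mod_cast hX a h, h⟩).2,
      fun h => (this.2 ⟨by exact_mod_cast hX b h, h⟩).2⟩
  let g : ℕ → ℕ := fun i => if i < a then i else i + (b - a)
  have g_lt : ∀ {i}, i < a → g i = i := fun h => if_pos h
  have g_ge : ∀ {i}, a ≤ i → g i = i + (b - a) := fun h => if_neg (by omega)
  have hstep : ∀ {α : Type _} (h : ℕ → α), h a = h b → ∀ i, h (g (i + 1)) = h (g i + 1) := by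
    intro α h hh i
    rcases lt_trichotomy (i + 1) a with hi | hi | hi
    · rw [g_lt hi, g_lt (by omega)]
    · rw [g_ge hi.ge, g_lt (by omega), hi, hh]
      congr 1
      omega
    · rw [g_ge hi.le, g_ge (by omega)]
      congr 1
      omega
  have h0 : ∀ {α : Type _} (h : ℕ → α), h a = h b → h (g 0) = h 0 := by
    intro α h hh
    rcases Nat.eq_zero_or_pos a with rfl | ha
    · rw [g_ge le_rfl, hh]
      congr 1
      omega
    · rw [g_lt ha]
  obtain ⟨ρ, D, hρ, hρ0, hD, hXD, hD0, hDn⟩ := ih (n - (b - a)) (by omega)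
    (π := fun i => π (g i)) (C := fun i => C (g i))
    (hπ.of_tail (p := a) (q := b) (fun k => by
      rw [g_ge (by omega)]
      congr 1
      omega) fun i => by
      rw [hstep π hs]
      exact hπ.edge _)
    (hC.reindex g (hstep C hc) fun n => ⟨n + a, fun i hi => by rw [g_ge (by omega)]; omega⟩)
    (fun i => hX _) (fun i hi => hn _ (by rw [g_ge (by omega)]; omega))
  exact ⟨ρ, D, hρ, hρ0.trans (h0 π hs), hD, hXD, hD0.trans (h0 C hc), hDn⟩

theorem Cert.witnesses_of_short {Lf : S → NNF S → Prop} {π : ℕ → S} {C : ℕ → Set (NNF S)}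
    (hC : Cert Lf π C) {n : ℕ} (hn : ∀ i ≥ n, C i = ∅) : Witnesses n C := by
  intro i f hf
  obtain ⟨j, hj, -⟩ := exists_of_step (P := fun i => NNF.pev f ∈ C i) (B := fun i => f ∈ C i)
    (D := fun _ => True) (fun i h => (hC.loc i _ h).imp_right fun h => ⟨trivial, h⟩)
    (n := n) (fun i hi => by simp [hn i hi]) hf
  refine ⟨j, ?_, hj⟩
  by_contra h
  simp [hn (i + j) (by omega)] at hj

/-! ### Changing the bound -/

theorem Witnesses.of_pevFree {N : ℕ} {C : ℕ → Set (NNF S)} {f : NNF S} (hf : f.PevFree)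
    (hX : ∀ i, C i ⊆ f.cl) : Witnesses N C := fun i _ hg =>
  (NNF.pevFree_of_mem_cl (by exact_mod_cast hX i hg) hf : NNF.PevFree (.pev _)).elim

theorem Windows.of_palwFree {N : ℕ} {C : ℕ → Set (NNF S)} {f : NNF S} (hf : f.PalwFree)
    (hX : ∀ i, C i ⊆ f.cl) : Windows N C := fun i _ hg =>
  (NNF.palwFree_of_mem_cl (by exact_mod_cast hX i hg) hf : NNF.PalwFree (.palw _)).elim

/-- Inevitability passes from the bound `K` to `K'` if satisfiability of the negation passes from
`K'` to `K`. -/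
theorem Inevitable.change {E : S → S → Prop} {K K' : ℕ} {f : NNF S}
    (h : ∀ π, Fair E π → f.neg.Sat K' π 0 → ∃ ρ, Fair E ρ ∧ ρ 0 = π 0 ∧ f.neg.Sat K ρ 0)
    {s : S} (hs : Inevitable E K s f) : Inevitable E K' s f := by
  intro ρ hρ h0 j
  by_contra hj
  obtain ⟨σ, hσ, hσ0, hσf⟩ := h _ (hρ.shift j)
    ((NNF.sat_shift K' ρ j _ 0).2 ((NNF.sat_neg ..).2 hj))
  have hsp : (if 0 < j then ρ 0 else σ (0 - j)) = s := by
    rcases Nat.eq_zero_or_pos j with rfl | hj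
    · simpa [hσ0] using h0
    · simpa [hj] using h0
  have h1 := hs _ (hρ.splice hσ hσ0) hsp j
  refine (NNF.sat_neg ..).1 hσf ?_
  have h2 := NNF.sat_shift K (fun k => if k < j then ρ k else σ (k - j)) j f 0
  simp only [add_zero, Nat.add_sub_cancel_left,
    Nat.not_lt.2 (Nat.le_add_right _ _), if_false] at h2
  exact h2.2 h1

/-- Beyond the bound, a formula with windows but without bounded eventualities remains satisfiable
by fair paths when the windows get longer, and one with bounded eventualities but without windows
when the eventualities get tighter. The two statements are used for each other: the leaves of a
certificate refer to all fair paths, hence to negations of smaller formulas. -/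
theorem sat_change [Fintype S] {E : S → S → Prop} {N : ℕ} (f : NNF S)
    (hN : Fintype.card S * f.length * 2 ^ f.length ≤ N) :
    (f.PevFree → ∀ π, Fair E π → f.Sat N π 0 →
      ∃ ρ, Fair E ρ ∧ ρ 0 = π 0 ∧ f.Sat (N + 1) ρ 0) ∧
    (f.PalwFree → ∀ π, Fair E π → f.Sat (N + 1) π 0 →
      ∃ ρ, Fair E ρ ∧ ρ 0 = π 0 ∧ f.Sat N ρ 0) := by
  induction hL : f.length using Nat.strong_induction_on generalizing f with
  | _ L ih =>
  have ih' : ∀ g : NNF S, g.length < f.length →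
      (g.PevFree → ∀ s, Inevitable E N s g → Inevitable E (N + 1) s g) ∧
      (g.PalwFree → ∀ s, Inevitable E (N + 1) s g → Inevitable E N s g) := by
    intro g hg
    have hb : Fintype.card S * g.neg.length * 2 ^ g.neg.length ≤ N := by
      rw [NNF.length_neg]
      refine le_trans ?_ hN
      gcongr
      norm_num
    have h := ih g.neg.length (by rw [NNF.length_neg]; omega) g.neg hb rfl
    exact ⟨fun hf s => .change (h.2 ((NNF.palwFree_neg g).2 hf)),
      fun hf s => .change (h.1 ((NNF.pevFree_neg g).2 hf))⟩
  obtain ⟨φ, hφ⟩ := f.exists_lit_mem_cl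
  constructor
  · intro hf π hπ hs
    obtain ⟨C, hC, hfC⟩ := hπ.provable hs
    obtain ⟨ρ, D, hρ, h0, hD, hW, hX, hD0⟩ :=
      exists_longer_windows f.card_cl_le hN hφ hπ hC.cert hC.windows hC.sub
    refine ⟨ρ, hρ, h0, Cert.sat (hD.mono_leaf ?_ ?_) hW (.of_pevFree hf hX) hρ (hD0 ▸ hfC)⟩
    · intro i g h hm
      have hm : NNF.rels g h ∈ f.cl := by exact_mod_cast hX i hm
      have h1 := NNF.length_le_of_mem_cl hm
      exact (ih' h (by simp only [NNF.length] at h1; omega)).1 (NNF.pevFree_of_mem_cl hm hf).2 _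
    · intro i g hm
      have hm : NNF.alw g ∈ f.cl := by exact_mod_cast hX i hm
      have h1 := NNF.length_le_of_mem_cl hm
      exact (ih' g (by simp only [NNF.length] at h1; omega)).1
        (NNF.pevFree_of_mem_cl hm hf : (NNF.alw g).PevFree) _
  · intro hf π hπ hs
    obtain ⟨C, hC, hfC⟩ := hπ.provable hs
    obtain ⟨ρ, D, hρ, h0, hD, hX, hD0, hDn⟩ := exists_short_cert hπ hC.cert hC.sub
    have hle : Fintype.card S * 2 ^ f.cl.card ≤ N := by
      refine le_trans ?_ hN
      have h1 : 2 ^ f.cl.card ≤ 2 ^ f.length := Nat.pow_le_pow_right (by norm_num) f.card_cl_le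
      have h2 := f.length_pos
      gcongr
      exact Nat.le_mul_of_pos_right _ h2
    refine ⟨ρ, hρ, h0, Cert.sat (hD.mono_leaf ?_ ?_) (.of_palwFree hf hX)
      (hD.witnesses_of_short fun i hi => hDn i (hle.trans hi)) hρ (hD0 ▸ hfC)⟩
    · intro i g h hm
      have hm : NNF.rels g h ∈ f.cl := by exact_mod_cast hX i hm
      have h1 := NNF.length_le_of_mem_cl hm
      exact (ih' h (by simp only [NNF.length] at h1; omega)).2 (NNF.palwFree_of_mem_cl hm hf).2 _
    · intro i g hm
      have hm : NNF.alw g ∈ f.cl := by exact_mod_cast hX i hm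
      have h1 := NNF.length_le_of_mem_cl hm
      exact (ih' g (by simp only [NNF.length] at h1; omega)).2
        (NNF.palwFree_of_mem_cl hm hf : (NNF.alw g).PalwFree) _

/-- A formula without bounded eventualities that is satisfiable by fair paths for the parameter
value `card S * |f| * 2 ^ |f|` is so for all larger values. -/
theorem exists_fair_sat_of_le [Fintype S] {E : S → S → Prop} {f : NNF S} (hf : f.PevFree) {N K : ℕ}
    (hN : Fintype.card S * f.length * 2 ^ f.length ≤ N) (hK : N ≤ K) {π : ℕ → S} (hπ : Fair E π)
    (hs : f.Sat N π 0) : ∃ ρ, Fair E ρ ∧ ρ 0 = π 0 ∧ f.Sat K ρ 0 := by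
  induction K, hK using Nat.le_induction with
  | base => exact ⟨π, hπ, rfl, hs⟩
  | succ K hK ih =>
    obtain ⟨ρ, hρ, h0, h⟩ := ih
    obtain ⟨σ, hσ, h0', h'⟩ := (sat_change f (hN.trans hK)).1 hf ρ hρ h
    exact ⟨σ, hσ, h0'.trans h0, h'⟩

/-! ### Almost every path is fair -/

namespace MarkovChain

open Finset Preorder Kernel

variable {S AP : Type*} [Fintype S] (M : MarkovChain S AP)

/-- The graph of the transitions of positive probability. -/
def Edge (s t : S) : Prop := 0 < M.P s t

variable [MeasurableSpace S] [DiscreteMeasurableSpace S]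

instance : IsProbabilityMeasure M.pathMeasure := by unfold pathMeasure; infer_instance

/-- The Markov property: a transition from `s` to `t` after a history in `A`, which ends in `s`. -/
theorem traj_step {a n : ℕ} (han : a ≤ n) (x : (_ : Iic a) → S) (A : Set ((_ : Iic n) → S))
    {s t : S} (hA : ∀ h ∈ A, h ⟨n, mem_Iic.2 le_rfl⟩ = s) :
    traj (X := fun _ => S) M.historyKernel a x {π | frestrictLe n π ∈ A ∧ π (n + 1) = t} =
      ENNReal.ofReal (M.P s t) *
        traj (X := fun _ => S) M.historyKernel a x {π | frestrictLe n π ∈ A} := by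
  have mA : MeasurableSet A := A.toFinite.measurableSet
  have mt : MeasurableSet ({t} : Set S) := .of_discrete
  have h1 := partialTraj_compProd_eq_map_traj (X := fun _ => S) (κ := M.historyKernel) han (x₀ := x)
  have h2 := congrArg (fun μ => μ (A ×ˢ {t})) h1
  rw [Measure.compProd_apply_prod mA mt,
    Measure.map_apply (by fun_prop) (mA.prod mt)] at h2
  have h3 : (fun π : ℕ → S => (frestrictLe (π := fun _ => S) n π, π (n + 1))) ⁻¹' A ×ˢ {t} =
      {π | frestrictLe (π := fun _ => S) n π ∈ A ∧ π (n + 1) = t} := rfl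
  rw [h3] at h2
  rw [← h2, setLIntegral_congr_fun (g := fun _ => ENNReal.ofReal (M.P s t)) mA,
    MeasureTheory.setLIntegral_const,
    ← traj_map_frestrictLe_apply, Measure.map_apply (by fun_prop) mA]
  · rfl
  · intro h hh
    change (M.step (h ⟨n, _⟩)).toMeasure {t} = _
    rw [PMF.toMeasure_apply_singleton _ _ mt, hA h hh]
    rfl

theorem ae_zero : ∀ᵐ π ∂M.pathMeasure, π 0 = M.s₀ := by
  have h := traj_map_frestrictLe_apply (X := fun _ => S) (κ := M.historyKernel) 0 0 fun _ => M.s₀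
  rw [partialTraj_self, Kernel.id_apply] at h
  have h1 : ∀ᵐ x ∂(traj (X := fun _ => S) M.historyKernel 0 fun _ => M.s₀).map (frestrictLe 0),
      x = fun _ => M.s₀ := by
    rw [h, ae_dirac_iff (Set.toFinite _).measurableSet]
  have h2 := ae_of_ae_map (by fun_prop) h1
  filter_upwards [h2] with π hπ
  exact congrFun hπ ⟨0, mem_Iic.2 le_rfl⟩

theorem measure_step (n : ℕ) (A : Set ((_ : Iic n) → S))
    {s t : S} (hA : ∀ h ∈ A, h ⟨n, mem_Iic.2 le_rfl⟩ = s) :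
    M.pathMeasure {π | frestrictLe n π ∈ A ∧ π (n + 1) = t} =
      ENNReal.ofReal (M.P s t) * M.pathMeasure {π | frestrictLe n π ∈ A} :=
  M.traj_step (Nat.zero_le n) _ A hA

theorem ae_edge : ∀ᵐ π ∂M.pathMeasure, ∀ i, M.Edge (π i) (π (i + 1)) := by
  rw [ae_all_iff]
  intro n
  have h : ∀ s t : S, ∀ᵐ π ∂M.pathMeasure, π n = s → π (n + 1) = t → M.Edge s t := by
    intro s t
    by_cases hE : M.Edge s t
    · exact .of_forall fun _ _ _ => hE
    have h1 := M.measure_step n {h | h ⟨n, mem_Iic.2 le_rfl⟩ = s} (t := t) fun h hh => hh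
    rw [ENNReal.ofReal_of_nonpos (not_lt.1 hE), zero_mul] at h1
    refine measure_mono_null ?_ h1
    intro π hπ
    simp only [Set.mem_compl_iff, Set.mem_ofPred_eq, Classical.not_imp] at hπ
    exact ⟨hπ.1, hπ.2.1⟩
  filter_upwards [ae_all_iff.2 fun s => ae_all_iff.2 (h s)] with π hπ
  exact hπ _ _ rfl rfl

theorem measure_cylinder_pos {u : ℕ → S} (h0 : u 0 = M.s₀) (n : ℕ)
    (hu : ∀ i < n, M.Edge (u i) (u (i + 1))) :
    0 < M.pathMeasure {π | ∀ k ≤ n, π k = u k} := by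
  induction n with
  | zero =>
    have h : M.pathMeasure {π | ∀ k ≤ 0, π k = u k} = M.pathMeasure Set.univ := by
      refine measure_congr ?_
      filter_upwards [M.ae_zero] with π hπ
      refine eq_true ?_
      intro k hk
      obtain rfl : k = 0 := by omega
      rw [hπ, h0]
    rw [h, measure_univ]
    exact one_pos
  | succ n ih =>
    have h := M.measure_step n {h | ∀ k : Iic n, h k = u k} (s := u n) (t := u (n + 1))
      fun h hh => hh _
    have h1 : {π : ℕ → S | ∀ k ≤ n + 1, π k = u k} =
        {π | frestrictLe (π := fun _ => S) n π ∈ {h : (_ : Iic n) → S | ∀ k : Iic n, h k = u k} ∧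
          π (n + 1) = u (n + 1)} := by
      ext π
      simp only [Set.mem_ofPred_eq, frestrictLe_apply, Subtype.forall, mem_Iic]
      exact ⟨fun h => ⟨fun k hk => h k (by omega), h _ le_rfl⟩, fun h k hk =>
        (Nat.le_succ_iff.1 hk).elim (h.1 k) fun hk => hk ▸ h.2⟩
    have h2 : {π : ℕ → S | ∀ k ≤ n, π k = u k} =
        {π | frestrictLe (π := fun _ => S) n π ∈ {h : (_ : Iic n) → S | ∀ k : Iic n, h k = u k}} := by
      ext π
      simp only [Set.mem_ofPred_eq, frestrictLe_apply, Subtype.forall, mem_Iic]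
    rw [h1, h, ← h2]
    exact ENNReal.mul_pos (ENNReal.ofReal_pos.2 (hu n (by omega))).ne'
      (ih fun i hi => hu i (by omega)).ne'

/-- If infinitely often a condition on the history holds that forces the present state to be `s`,
then almost surely the transition from `s` to `t` is taken infinitely often under this condition.
This is Lévy's version of the Borel–Cantelli lemma. -/
theorem ae_frequently_step {s t : S} (hE : M.Edge s t) (A : (n : ℕ) → Set ((_ : Iic n) → S))
    (hA : ∀ n, ∀ h ∈ A n, h ⟨n, mem_Iic.2 le_rfl⟩ = s) :
    ∀ᵐ π ∂M.pathMeasure, (∃ᶠ n in atTop, frestrictLe (π := fun _ => S) n π ∈ A n) →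
      ∃ᶠ n in atTop, frestrictLe (π := fun _ => S) n π ∈ A n ∧ π (n + 1) = t := by
  let D : ℕ → Set (ℕ → S) := fun n => {π | frestrictLe n π ∈ A n}
  let B : ℕ → Set (ℕ → S)
    | 0 => ∅
    | n + 1 => {π | frestrictLe n π ∈ A n ∧ π (n + 1) = t}
  have mB' : ∀ n, MeasurableSet[Filtration.piLE (X := fun _ => S) n] (B n) := by
    rintro (_ | n)
    · exact @MeasurableSet.empty _ (Filtration.piLE (X := fun _ => S) 0)
    · refine ⟨{h | (fun k : Iic n => h ⟨k, (mem_Iic.1 k.2).trans n.le_succ⟩) ∈ A n ∧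
        h ⟨n + 1, Set.mem_Iic.2 le_rfl⟩ = t}, (Set.toFinite _).measurableSet, rfl⟩
  have mB : ∀ n, MeasurableSet (B n) := fun n => Filtration.le _ n _ (mB' n)
  have hcond : ∀ n, M.pathMeasure[(B (n + 1)).indicator (1 : (ℕ → S) → ℝ) |
      Filtration.piLE (X := fun _ => S) n] =ᵐ[M.pathMeasure]
      fun π => M.P s t * (D n).indicator 1 π := by
    intro n
    have h := condExp_traj (X := fun _ => S) (κ := M.historyKernel) (Nat.zero_le n)
      (x₀ := fun _ => M.s₀) (f := (B (n + 1)).indicator (1 : (ℕ → S) → ℝ))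
      ((integrable_const 1).indicator (mB (n + 1)))
    refine h.trans (.of_forall fun π => ?_)
    simp only
    rw [integral_indicator_one (mB (n + 1))]
    have h1 := M.traj_step le_rfl (frestrictLe n π) (A n) (t := t) (hA n)
    have h2 := traj_map_frestrictLe_apply (X := fun _ => S) (κ := M.historyKernel) n n
      (frestrictLe n π)
    rw [partialTraj_self, Kernel.id_apply] at h2
    have h3 : traj (X := fun _ => S) M.historyKernel n (frestrictLe n π)
        {ρ | frestrictLe n ρ ∈ A n} = (A n).indicator 1 (frestrictLe (π := fun _ => S) n π) := by
      have mA := (A n).toFinite.measurableSet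
      rw [← Measure.dirac_apply' _ mA, ← h2, Measure.map_apply (by fun_prop) mA]
      rfl
    rw [h3] at h1
    change (traj (X := fun _ => S) M.historyKernel n (frestrictLe n π)
      {ρ | frestrictLe n ρ ∈ A n ∧ ρ (n + 1) = t}).toReal = _
    rw [h1, ENNReal.toReal_mul, ENNReal.toReal_ofReal (M.P_nonneg s t)]
    congr 1
    by_cases hm : frestrictLe n π ∈ A n
    · have hm' : π ∈ D n := hm
      simp [hm, hm']
    · have hm' : π ∉ D n := hm
      simp [hm, hm']
  filter_upwards [ae_mem_limsup_atTop_iff (ℱ := Filtration.piLE (X := fun _ => S))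
    M.pathMeasure mB', ae_all_iff.2 hcond] with π h1 h2 hD
  have hD' : π ∈ limsup D atTop := mem_limsup_iff_frequently_mem.2 hD
  rw [Set.limsup_eq_tendsto_sum_indicator_atTop (one_pos : (0 : ℝ) < 1) D] at hD'
  have h3 : π ∈ limsup B atTop := by
    rw [h1]
    simp_rw [h2, ← Finset.mul_sum]
    exact Tendsto.const_mul_atTop hE hD'
  rw [mem_limsup_iff_frequently_mem, frequently_atTop] at h3
  rw [frequently_atTop]
  intro a
  obtain ⟨b, hb, h⟩ := h3 (a + 1)
  obtain ⟨c, rfl⟩ := Nat.exists_eq_add_of_le' (show 1 ≤ b by omega)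
  exact ⟨c, by omega, h⟩

theorem ae_frequently_fragment (u : ℕ → S) (n : ℕ) (hu : ∀ i < n, M.Edge (u i) (u (i + 1))) :
    ∀ᵐ π ∂M.pathMeasure, (∃ᶠ i in atTop, π i = u 0) → ∃ᶠ i in atTop, ∀ j ≤ n, π (i + j) = u j := by
  induction n with
  | zero => exact .of_forall fun π h => h.mono fun i hi => by simpa using hi
  | succ n ih =>
    let A : (m : ℕ) → Set ((_ : Iic m) → S) := fun m =>
      {h | ∃ hnm : n ≤ m, ∀ j (hj : j ≤ n), h ⟨m - n + j, mem_Iic.2 (by omega)⟩ = u j}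
    have hA : ∀ m, ∀ h ∈ A m, h ⟨m, mem_Iic.2 le_rfl⟩ = u n := by
      rintro m h ⟨hnm, hh⟩
      have := hh n le_rfl
      simpa only [Nat.sub_add_cancel hnm] using this
    filter_upwards [ih fun i hi => hu i (by omega),
      M.ae_frequently_step (hu n (by omega)) A hA] with π h1 h2 h0
    have h3 : ∃ᶠ m in atTop, frestrictLe (π := fun _ => S) m π ∈ A m := by
      rw [frequently_atTop]
      intro a
      obtain ⟨b, hb, h⟩ := frequently_atTop.1 (h1 h0) a
      refine ⟨b + n, by omega, by omega, fun j hj => ?_⟩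
      simpa using h j hj
    rw [frequently_atTop]
    intro a
    obtain ⟨b, hb, ⟨hnb, h⟩, h'⟩ := frequently_atTop.1 (h2 h3) (a + n)
    refine ⟨b - n, by omega, fun j hj => ?_⟩
    rcases Nat.le_succ_iff.1 hj with hj | rfl
    · exact h j hj
    · rw [← h']
      congr 1
      omega

theorem ae_fair : ∀ᵐ π ∂M.pathMeasure, Fair M.Edge π := by
  -- countably many fragments suffice: only the first `n + 1` values of `u` matter
  have h : ∀ᵐ π ∂M.pathMeasure, ∀ (n : ℕ) (w : Fin (n + 1) → S),
      (∀ i < n, M.Edge (w (Fin.ofNat (n + 1) i)) (w (Fin.ofNat (n + 1) (i + 1)))) →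
      (∃ᶠ i in atTop, π i = w (Fin.ofNat (n + 1) 0)) →
      ∃ᶠ i in atTop, ∀ j ≤ n, π (i + j) = w (Fin.ofNat (n + 1) j) := by
    refine ae_all_iff.2 fun n => ae_all_iff.2 fun w => ?_
    by_cases hw : ∀ i < n, M.Edge (w (Fin.ofNat (n + 1) i)) (w (Fin.ofNat (n + 1) (i + 1)))
    · filter_upwards [M.ae_frequently_fragment (fun j => w (Fin.ofNat (n + 1) j)) n hw] with π h _
      exact h
    · exact .of_forall fun π h => (hw h).elim
  filter_upwards [M.ae_edge, h] with π he h
  refine ⟨he, fun u n hu h0 => ?_⟩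
  have hv : ∀ j ≤ n, (Fin.ofNat (n + 1) j : ℕ) = j := fun j hj => Nat.mod_eq_of_lt (by omega)
  refine (h n (fun j => u j) (fun i hi => ?_) ?_).mono fun i hi j hj => ?_
  · rw [hv i hi.le, hv (i + 1) hi]
    exact hu i hi
  · rwa [hv 0 (by omega)]
  · rw [hi j hj, hv j hj]

end MarkovChain

/-! ### From parametric formulas to state formulas -/

namespace Formula

variable {S AP Var : Type*}

/-- The formula over states obtained from a labelling, the parameters being identified. -/
def toNNF (L : S → Set AP) : Formula AP Var → NNF S
  | atom a => .lit fun s => a ∈ L s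
  | natom a => .lit fun s => a ∉ L s
  | and φ ψ => .and (φ.toNNF L) (ψ.toNNF L)
  | or φ ψ => .or (φ.toNNF L) (ψ.toNNF L)
  | next φ => .next (φ.toNNF L)
  | .until φ ψ => .untl (φ.toNNF L) (ψ.toNNF L)
  | release φ ψ => .rels (φ.toNNF L) (ψ.toNNF L)
  | always φ => .alw (φ.toNNF L)
  | eventuallyLEVar _ φ => .pev (φ.toNNF L)
  | eventuallyLEConst c φ => .bex c (φ.toNNF L)
  | alwaysLEConst c φ => .ball c (φ.toNNF L)

theorem length_toNNF (L : S → Set AP) (φ : Formula AP Var) : (φ.toNNF L).length = φ.length := by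
  induction φ <;> simp_all [toNNF, length, NNF.length]

theorem palwFree_toNNF (L : S → Set AP) (φ : Formula AP Var) : (φ.toNNF L).PalwFree := by
  induction φ <;> simp_all [toNNF, NNF.PalwFree]

theorem exists_until_iff {P Q : ℕ → Prop} {i : ℕ} :
    (∃ j, i ≤ j ∧ Q j ∧ ∀ k, i ≤ k → k < j → P k) ↔ ∃ j, Q (i + j) ∧ ∀ k < j, P (i + k) := by
  constructor
  · rintro ⟨j, hj, hQ, hP⟩
    obtain ⟨d, rfl⟩ := Nat.exists_eq_add_of_le hj
    exact ⟨d, hQ, fun k hk => hP _ (by omega) (by omega)⟩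
  · rintro ⟨j, hQ, hP⟩
    refine ⟨i + j, by omega, hQ, fun k hk hkj => ?_⟩
    obtain ⟨d, rfl⟩ := Nat.exists_eq_add_of_le hk
    exact hP d (by omega)

theorem exists_bounded_iff {P : ℕ → Prop} {i c : ℕ} :
    (∃ j, i ≤ j ∧ j ≤ i + c ∧ P j) ↔ ∃ j ≤ c, P (i + j) := by
  constructor
  · rintro ⟨j, hj, hc, hP⟩
    obtain ⟨d, rfl⟩ := Nat.exists_eq_add_of_le hj
    exact ⟨d, by omega, hP⟩
  · rintro ⟨j, hj, hP⟩
    exact ⟨i + j, by omega, by omega, hP⟩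

theorem sat_toNNF (L : S → Set AP) (K : ℕ) (π : ℕ → S) (φ : Formula AP Var) (i : ℕ) :
    (φ.toNNF L).Sat K π i ↔ φ.Sat (fun i => L (π i)) (fun _ => K) i := by
  induction φ generalizing i with
  | release φ ψ hφ hψ =>
    simp only [toNNF, Sat, NNF.Sat, exists_until_iff, hφ, hψ]
    push Not
    exact forall_congr' fun j => or_iff_not_imp_left
  | always φ h =>
    simp only [toNNF, Sat, NNF.Sat, h]
    refine ⟨fun H j hj => ?_, fun H j => H _ (by omega)⟩
    obtain ⟨d, rfl⟩ := Nat.exists_eq_add_of_le hj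
    exact H d
  | eventuallyLEVar x φ h => simp only [toNNF, Sat, NNF.Sat, exists_bounded_iff, h]
  | eventuallyLEConst c φ h => simp only [toNNF, Sat, NNF.Sat, exists_bounded_iff, h]
  | alwaysLEConst c φ h =>
    simp only [toNNF, Sat, NNF.Sat, h]
    refine ⟨fun H j hj hc => ?_, fun H j hj => H _ (by omega) (by omega)⟩
    obtain ⟨d, rfl⟩ := Nat.exists_eq_add_of_le hj
    exact H d (by omega)
  | _ => simp_all [toNNF, Sat, NNF.Sat, exists_until_iff]

/-- Satisfaction is monotone in the valuation, and only finitely many variables occur. -/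
theorem exists_uniform (v : Var → ℕ) (φ : Formula AP Var) :
    ∃ K₀, ∀ K ≥ K₀, ∀ w i, φ.Sat w v i → φ.Sat w (fun _ => K) i := by
  induction φ with
  | atom a | natom a => exact ⟨0, fun K _ w i h => h⟩
  | and φ ψ hφ hψ =>
    obtain ⟨A, hA⟩ := hφ
    obtain ⟨B, hB⟩ := hψ
    exact ⟨max A B, fun K hK w i h =>
      ⟨hA K (by omega) w i h.1, hB K (by omega) w i h.2⟩⟩
  | or φ ψ hφ hψ =>
    obtain ⟨A, hA⟩ := hφ
    obtain ⟨B, hB⟩ := hψ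
    exact ⟨max A B, fun K hK w i h => h.imp (hA K (by omega) w i) (hB K (by omega) w i)⟩
  | next φ h =>
    obtain ⟨A, hA⟩ := h
    exact ⟨A, fun K hK w i h => hA K hK w _ h⟩
  | release φ ψ hφ hψ =>
    obtain ⟨A, hA⟩ := hφ
    obtain ⟨B, hB⟩ := hψ
    refine ⟨max A B, fun K hK w i hs => ?_⟩
    rintro ⟨j, hj, h, h'⟩
    exact hs ⟨j, hj, fun c => h (hB K (by omega) w _ c),
      fun k hk hkj c => h' k hk hkj (hA K (by omega) w _ c)⟩
  | always φ h =>
    obtain ⟨A, hA⟩ := h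
    exact ⟨A, fun K hK w i h j hj => hA K hK w _ (h j hj)⟩
  | eventuallyLEVar x φ h =>
    obtain ⟨A, hA⟩ := h
    refine ⟨max A (v x), fun K hK w i => ?_⟩
    rintro ⟨j, hj, hjv, h⟩
    exact ⟨j, hj, by simp only; omega, hA K (by omega) w _ h⟩
  | eventuallyLEConst c φ h =>
    obtain ⟨A, hA⟩ := h
    refine ⟨A, fun K hK w i => ?_⟩
    rintro ⟨j, hj, hjv, h⟩
    exact ⟨j, hj, hjv, hA K hK w _ h⟩
  | alwaysLEConst c φ h =>
    obtain ⟨A, hA⟩ := h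
    exact ⟨A, fun K hK w i h j hj hjc => hA K hK w _ (h j hj hjc)⟩
  | _ φ ψ hφ hψ =>
    obtain ⟨A, hA⟩ := hφ
    obtain ⟨B, hB⟩ := hψ
    refine ⟨max A B, fun K hK w i => ?_⟩
    rintro ⟨j, hj, h, h'⟩
    exact ⟨j, hj, hB K (by omega) w _ h, fun k hk hkj => hA K (by omega) w _ (h' k hk hkj)⟩

end Formula

namespace MarkovChain

variable {S AP Var : Type*} [Fintype S] [MeasurableSpace S] [DiscreteMeasurableSpace S]
  (M : MarkovChain S AP) (φ : Formula AP Var)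

/-- For a uniform valuation, almost sure satisfaction is satisfaction on all fair paths: a violation
on a fair path is already decided by a finite prefix, which has positive probability. -/
theorem const_mem_VEqOne_iff (K : ℕ) :
    (fun _ => K) ∈ M.VEqOne φ ↔
      ∀ π, Fair M.Edge π → π 0 = M.s₀ → (φ.toNNF M.L).Sat K π 0 := by
  constructor
  · intro hK π hπ h0
    by_contra hs
    obtain ⟨n, hn⟩ := (hπ.provable ((NNF.sat_neg ..).2 hs)).determined
    have hpos := M.measure_cylinder_pos h0 n fun i _ => hπ.edge i
    have mcyl : MeasurableSet {ρ : ℕ → S | ∀ k ≤ n, ρ k = π k} := by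
      measurability
    have hle : M.prob φ (fun _ => K) ≤ M.pathMeasure {ρ : ℕ → S | ∀ k ≤ n, ρ k = π k}ᶜ := by
      refine measure_mono_ae ?_
      filter_upwards [M.ae_fair] with ρ hρ hmem hcyl
      exact (NNF.sat_neg ..).1 (hn ρ hρ hcyl) ((Formula.sat_toNNF M.L ..).2 hmem.2)
    rw [show M.prob φ (fun _ => K) = 1 from hK, prob_compl_eq_one_sub mcyl] at hle
    exact (ENNReal.sub_lt_self ENNReal.one_ne_top one_ne_zero hpos.ne').not_ge hle
  · intro h
    change M.pathMeasure _ = 1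
    rw [← measure_univ (μ := M.pathMeasure)]
    refine measure_congr ?_
    filter_upwards [M.ae_fair, M.ae_zero] with π hπ h0
    exact eq_true ⟨⟨h0, hπ.edge⟩, (Formula.sat_toNNF M.L ..).1 (h π hπ h0)⟩

end MarkovChain

end PLTL

theorem theorem5 {S AP Var : Type*} [Fintype S] [MeasurableSpace S] [DiscreteMeasurableSpace S]
    (M : PLTL.MarkovChain S AP) (φ : PLTL.Formula AP Var) :
    (M.VEqOne φ).Nonempty ↔
      (fun _ : Var => Fintype.card S * φ.length * 2 ^ φ.length) ∈ M.VEqOne φ := by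
  refine ⟨?_, fun h => ⟨_, h⟩⟩
  rintro ⟨v, hv⟩
  obtain ⟨K₀, hK₀⟩ := φ.exists_uniform v
  set N := Fintype.card S * φ.length * 2 ^ φ.length with hN
  have hK : (fun _ => max K₀ N) ∈ M.VEqOne φ := by
    refine le_antisymm MeasureTheory.prob_le_one (hv.symm.le.trans (MeasureTheory.measure_mono ?_))
    exact fun π hπ => ⟨hπ.1, hK₀ _ (le_max_left _ _) _ _ hπ.2⟩
  rw [M.const_mem_VEqOne_iff] at hK ⊢
  intro π hπ h0
  by_contra hs
  obtain ⟨ρ, hρ, hρ0, hρs⟩ := PLTL.exists_fair_sat_of_le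
    ((PLTL.NNF.pevFree_neg _).2 (φ.palwFree_toNNF M.L))
    (by rw [PLTL.NNF.length_neg, φ.length_toNNF]) (le_max_right K₀ N) hπ
    ((PLTL.NNF.sat_neg ..).2 hs)
  exact (PLTL.NNF.sat_neg ..).1 hρs (hK ρ hρ (hρ0.trans h0))
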